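/- **Setting.** A (multi-message) shuffle protocol $\Pi$ with data universe $\mathcal X$, intended for $n$ users, consists of a public random string $w$, a randomizer that maps a user's datum $x\in\mathcal X$ (given $n$, $w$ and the user's own private randomness) to a finite sequence of messages of arbitrary length, and an analyzer that (given $n$, $w$ and private randomness) maps a uniformly random permutation of all users' messages to an output; $n$ ranges over $\mathbb N$. $\Pi$ is $(\varepsilon,\delta,1/3)$-robustly shuffle private if for all integers $n$ and $n/3\le h\le n$, the shuffled messages of $h$ users, together with the public string, are an $(\varepsilon,\delta)$-differentially private function of the data of these $h$ users. Let $1\le k\le d$ and $\mathcal X=\{\pm1\}^{d+1}$, where the last coordinate is the label. For a distribution $\mathbf D$ on $\mathcal X$, $\ell\subseteq[d]$ and $b\in\{\pm1\}$ let $\mathrm{err}_{\mathbf D}(\ell,b)=\Pr_{X\sim\mathbf D}[\,b\prod_{j\in\ell}X_j\ne X_{d+1}]$. $\Pi$ learns width-$k$ signed parities with error $\alpha$ and sample complexity $n$ if for every distribution $\mathbf D$ on $\mathcal X$, when run on $n$ independent samples from $\mathbf D$, it outputs $(L,B)\in 2^{[d]}\times\{\pm1\}$ such that with probability at least $99/100$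 $$\mathrm{err}_{\mathbf D}(L,B)<\min_{|\ell|\le k,\ b\in\{\pm1\}}\mathrm{err}_{\mathbf D}(\ell,b)+\alpha .$$ Write $\binom{d}{\le k}=\sum_{j=1}^k\binom dj$. **Theorem.** For every $\varepsilon_0>0$ there are constants $c_1,c_2>0$, depending only on $\varepsilon_0$, such that the following holds for all integers $1\le k\le d$ and $n\ge 0$ and all reals $0<\varepsilon\le\varepsilon_0$, $0\le\delta\le 1/2$, $0<\alpha\le 1/3$ with $$\delta\log\!\Big(\tbinom{d}{\le k}/\delta\Big)\le c_1\,\frac{\alpha^2\varepsilon^2}{\binom{d}{\le k}}$$ (the left side being $0$ for $\delta=0$). If $\Pi$ is an $(\varepsilon,\delta,1/3)$-robustly shuffle private protocol that learns width-$k$ signed parities with error $\alpha$ and sample complexity $n$, then $$n\ \ge\ c_2\,\frac{\sqrt{\binom{d}{\le k}}}{\alpha\varepsilon},\qquad\text{and if } k=d\text{, also}\qquad n\ \ge\ c_2\,\frac{2^{d/2}}{\alpha\varepsilon}.$$ -/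

import Mathlib

open MeasureTheory ProbabilityTheory
open scoped ENNReal Nat

universe u v w z

/-! ## Finite sequences of messages -/

/-- The space `Y^*` of finite sequences (of variable length) of messages from `Y`, with the
disjoint-union σ-algebra of the product σ-algebras on `Y^m`, `m ∈ ℕ`. -/
abbrev MsgSeq (Y : Type v) : Type v := Σ m : ℕ, (Fin m → Y)

namespace MsgSeq

variable {Y : Type v}

/-- The empty sequence of messages. -/
def empty : MsgSeq Y := ⟨0, Fin.elim0⟩

/-- Concatenation of two sequences of messages. -/
def append (a b : MsgSeq Y) : MsgSeq Y := ⟨a.1 + b.1, Fin.append a.2 b.2⟩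

/-- Rearrangement of a sequence of messages by a permutation of its positions. -/
def permute (s : MsgSeq Y) (σ : Equiv.Perm (Fin s.1)) : MsgSeq Y := ⟨s.1, s.2 ∘ σ⟩

theorem mk_injective (m : ℕ) :
    Function.Injective (fun f : Fin m → Y => (⟨m, f⟩ : MsgSeq Y)) :=
  fun _ _ h => eq_of_heq (Sigma.mk.inj h).2

variable [MeasurableSpace Y]

theorem measurable_mk (m : ℕ) : Measurable (fun f : Fin m → Y => (⟨m, f⟩ : MsgSeq Y)) := by
  intro s hs
  have h : MeasurableSet[⨅ a : ℕ, MeasurableSpace.map (Sigma.mk a) inferInstance] s := hs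
  rw [MeasurableSpace.measurableSet_iInf] at h
  exact h m

theorem measurable_of_components {β : Type*} [MeasurableSpace β] {g : MsgSeq Y → β}
    (hg : ∀ m : ℕ, Measurable (fun f : Fin m → Y => g ⟨m, f⟩)) : Measurable g := by
  intro s hs
  change MeasurableSet[⨅ a : ℕ, MeasurableSpace.map (Sigma.mk a) inferInstance] _
  rw [MeasurableSpace.measurableSet_iInf]
  exact fun m => hg m hs

theorem measurableEmbedding_mk (m : ℕ) :
    MeasurableEmbedding (fun f : Fin m → Y => (⟨m, f⟩ : MsgSeq Y)) where
  injective := mk_injective m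
  measurable := measurable_mk m
  measurableSet_image' := by
    intro s hs
    change MeasurableSet[⨅ a : ℕ, MeasurableSpace.map (Sigma.mk a) inferInstance] _
    rw [MeasurableSpace.measurableSet_iInf]
    intro a
    change MeasurableSet ((fun f : Fin a → Y => (⟨a, f⟩ : MsgSeq Y)) ⁻¹'
      ((fun f : Fin m → Y => (⟨m, f⟩ : MsgSeq Y)) '' s))
    by_cases h : a = m
    · subst h
      rwa [Set.preimage_image_eq _ (mk_injective a)]
    · convert MeasurableSet.empty
      ext f
      simp only [Set.mem_preimage, Set.mem_image, Set.mem_empty_iff_false, iff_false]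
      rintro ⟨g, -, hg⟩
      exact h (Sigma.mk.inj hg).1.symm

theorem measurable_append :
    Measurable (fun p : MsgSeq Y × MsgSeq Y => MsgSeq.append p.1 p.2) := by
  intro t ht
  have hpre : (fun p : MsgSeq Y × MsgSeq Y => MsgSeq.append p.1 p.2) ⁻¹' t =
      ⋃ m : ℕ, ⋃ k : ℕ, (Prod.map (fun f : Fin m → Y => (⟨m, f⟩ : MsgSeq Y))
        (fun f : Fin k → Y => (⟨k, f⟩ : MsgSeq Y))) ''
          ((fun p : (Fin m → Y) × (Fin k → Y) =>
            (⟨m + k, Fin.append p.1 p.2⟩ : MsgSeq Y)) ⁻¹' t) := by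
    ext p
    simp only [Set.mem_preimage, Set.mem_iUnion, Set.mem_image]
    constructor
    · intro h
      exact ⟨p.1.1, p.2.1, (p.1.2, p.2.2), h, rfl⟩
    · rintro ⟨m, k, q, hq, rfl⟩
      exact hq
  rw [hpre]
  refine MeasurableSet.iUnion fun m => MeasurableSet.iUnion fun k => ?_
  refine ((measurableEmbedding_mk m).prodMap (measurableEmbedding_mk k)).measurableSet_image.2 ?_
  refine ((measurable_mk (m + k)).comp (measurable_pi_lambda _ fun i => ?_)) ht
  refine Fin.addCases (fun j => ?_) (fun j => ?_) i
  · simp only [Fin.append_left]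
    exact (measurable_pi_apply j).comp measurable_fst
  · simp only [Fin.append_right]
    exact (measurable_pi_apply j).comp measurable_snd

end MsgSeq

/-! ## The shuffle model -/

/-- The shuffler: it applies a uniformly random permutation to a sequence of messages. -/
noncomputable def shuffler (Y : Type v) [MeasurableSpace Y] : Kernel (MsgSeq Y) (MsgSeq Y) where
  toFun s := ∑ σ : Equiv.Perm (Fin s.1), ((s.1 ! : ℕ) : ℝ≥0∞)⁻¹ • Measure.dirac (s.permute σ)
  measurable' := by
    refine MsgSeq.measurable_of_components fun m => ?_
    refine Measure.measurable_of_measurable_coe _ fun t ht => ?_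
    simp only [Measure.finsetSum_apply, Measure.smul_apply, smul_eq_mul]
    change Measurable fun f : Fin m → Y => ∑ σ : Equiv.Perm (Fin m),
      ((m ! : ℕ) : ℝ≥0∞)⁻¹ * Measure.dirac (MsgSeq.permute (⟨m, f⟩ : MsgSeq Y) σ) t
    refine Finset.measurable_fun_sum _ fun σ _ => Measurable.const_mul ?_ _
    refine (Measure.measurable_coe ht).comp (Measure.measurable_dirac.comp ?_)
    exact (MsgSeq.measurable_mk m).comp
      (measurable_pi_lambda _ fun i => measurable_pi_apply (σ i))

instance (Y : Type v) [MeasurableSpace Y] : IsMarkovKernel (shuffler Y) where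
  isProbabilityMeasure s := by
    constructor
    change (∑ σ : Equiv.Perm (Fin s.1), ((s.1 ! : ℕ) : ℝ≥0∞)⁻¹ • Measure.dirac (s.permute σ))
      Set.univ = 1
    simp only [Measure.finsetSum_apply, Measure.smul_apply, smul_eq_mul, measure_univ, mul_one,
      Finset.sum_const, Finset.card_univ, Fintype.card_perm, Fintype.card_fin, nsmul_eq_mul]
    exact ENNReal.mul_inv_cancel (by exact_mod_cast s.1.factorial_ne_zero)
      (ENNReal.natCast_ne_top _)

/-- A (multi-message) protocol in the shuffle model with data universe `X` (finite or discrete),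
public randomness in `W`, messages in `Y` and outputs in `O`.  The public random string has law
`coins`.  The natural number is the intended number `n` of users, which users and analyzer
know.  Given the public string, a user with datum `x` draws finitely many messages from
`randomizer n x`, and the analyzer draws its output given the public string and the shuffled
messages. -/
structure ShuffleProtocol (X : Type u) (W : Type w) (Y : Type v) (O : Type z)
    [MeasurableSpace W] [MeasurableSpace Y] [MeasurableSpace O] where
  coins : Measure W
  randomizer : ℕ → X → Kernel W (MsgSeq Y)
  analyzer : ℕ → Kernel (W × MsgSeq Y) O
  prob_coins : IsProbabilityMeasure coins
  markov_randomizer : ∀ n x, IsMarkovKernel (randomizer n x)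
  markov_analyzer : ∀ n, IsMarkovKernel (analyzer n)

namespace ShuffleProtocol

variable {X : Type u} {W : Type w} {Y : Type v} {O : Type z}
  [MeasurableSpace W] [MeasurableSpace Y] [MeasurableSpace O]

instance (P : ShuffleProtocol X W Y O) : IsProbabilityMeasure P.coins := P.prob_coins

instance (P : ShuffleProtocol X W Y O) (n : ℕ) (x : X) : IsMarkovKernel (P.randomizer n x) :=
  P.markov_randomizer n x

instance (P : ShuffleProtocol X W Y O) (n : ℕ) : IsMarkovKernel (P.analyzer n) :=
  P.markov_analyzer n

/-- The concatenation of the messages of `h` users with data `x`, given the public string, when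
the intended number of users is `n`.  The users randomize independently of each other. -/
noncomputable def messages (P : ShuffleProtocol X W Y O) (n : ℕ) :
    (h : ℕ) → (Fin h → X) → Kernel W (MsgSeq Y)
  | 0, _ => Kernel.const W (Measure.dirac MsgSeq.empty)
  | h + 1, x => ((P.randomizer n (x 0)) ×ₖ (P.messages n h (Fin.tail x))).map
      (fun p => MsgSeq.append p.1 p.2)

instance isMarkovKernel_messages (P : ShuffleProtocol X W Y O) (n : ℕ) :
    ∀ (h : ℕ) (x : Fin h → X), IsMarkovKernel (P.messages n h x)
  | 0, _ => by unfold messages; infer_instance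
  | h + 1, x => by
    have := isMarkovKernel_messages P n h (Fin.tail x)
    unfold messages
    exact Kernel.IsMarkovKernel.map _ MsgSeq.measurable_append

/-- The view of the adversary when `h` out of `n` intended users, with data `x`, take part: the
joint law of the public string and of the shuffled messages of these `h` users. -/
noncomputable def view (P : ShuffleProtocol X W Y O) (n h : ℕ) (x : Fin h → X) :
    Measure (W × MsgSeq Y) :=
  P.coins ⊗ₘ (shuffler Y ∘ₖ P.messages n h x)

instance (P : ShuffleProtocol X W Y O) (n h : ℕ) (x : Fin h → X) :
    IsProbabilityMeasure (P.view n h x) := by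
  unfold view; infer_instance

/-- The law of the output of the honest execution on the data `x` of `n` users. -/
noncomputable def run (P : ShuffleProtocol X W Y O) (n : ℕ) (x : Fin n → X) : Measure O :=
  (P.view n n x).bind (P.analyzer n)

instance (P : ShuffleProtocol X W Y O) (n : ℕ) (x : Fin n → X) :
    IsProbabilityMeasure (P.run n x) := by
  unfold run; infer_instance

end ShuffleProtocol

/-! ## Differential privacy -/

/-- Two datasets are neighbors if they differ in at most one row. -/
def Neighbors {X : Type u} {h : ℕ} (x x' : Fin h → X) : Prop := {i | x i ≠ x' i}.Subsingleton

/-- `(ε, δ)`-differential privacy of a randomized algorithm on datasets of `h` rows, which is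
given by the law `M x` of its output on each dataset `x`. -/
def IsDifferentiallyPrivate {X : Type u} {R : Type z} [MeasurableSpace R] {h : ℕ}
    (M : (Fin h → X) → Measure R) (ε δ : ℝ) : Prop :=
  ∀ x x' : Fin h → X, Neighbors x x' → ∀ S : Set R, MeasurableSet S →
    M x S ≤ ENNReal.ofReal (Real.exp ε) * M x' S + ENNReal.ofReal δ

/-- `(ε, δ, γ)`-robust shuffle privacy: for every intended number `n` of users, the shuffled
messages are `(ε, δ)`-differentially private whenever the number `h ≤ n` of users that follow the
protocol is at least `γ n`. -/
def ShuffleProtocol.RobustlyPrivate {X : Type u} {W : Type w} {Y : Type v} {O : Type z}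
    [MeasurableSpace W] [MeasurableSpace Y] [MeasurableSpace O]
    (P : ShuffleProtocol X W Y O) (ε δ γ : ℝ) : Prop :=
  ∀ n h : ℕ, γ * n ≤ h → h ≤ n → IsDifferentiallyPrivate (P.view n h) ε δ

/-! ## Learning signed parities -/

/-- Labelled examples: points of `{±1}^{d+1}`; the last coordinate is the label. -/
abbrev Example (d : ℕ) : Type := Fin (d + 1) → ℤˣ

/-- A signed parity function on `d` bits: a set of coordinates and a sign. -/
structure SignedParity (d : ℕ) where
  support : Finset (Fin d)
  sign : ℤˣ

instance (d : ℕ) : MeasurableSpace (SignedParity d) := ⊤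

/-- The label `b ∏_{j ∈ ℓ} x_j` that the signed parity `(ℓ, b)` predicts for `x`. -/
def SignedParity.predict {d : ℕ} (f : SignedParity d) (x : Example d) : ℤˣ :=
  f.sign * ∏ j ∈ f.support, x j.castSucc

/-- The probability under `D` that a signed parity misclassifies a random example. -/
noncomputable def SignedParity.err {d : ℕ} (D : PMF (Example d)) (f : SignedParity d) : ℝ :=
  ∑ x : Example d with f.predict x ≠ x (Fin.last d), (D x).toReal

/-- The protocol learns width-`k` signed parities with error `α` and sample complexity `n`: on
`n` independent samples from any distribution `D`, with probability at least `99/100` the error of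
the output exceeds the least error of a signed parity of width at most `k` by less than `α`. -/
def ShuffleProtocol.LearnsSignedParities {d : ℕ} {W : Type w} {Y : Type v}
    [MeasurableSpace W] [MeasurableSpace Y]
    (P : ShuffleProtocol (Example d) W Y (SignedParity d)) (k : ℕ) (α : ℝ) (n : ℕ) : Prop :=
  ∀ D : PMF (Example d),
    (99 / 100 : ℝ≥0∞) ≤ ∑ x : Fin n → Example d, (∏ i, D (x i)) *
      P.run n x {f | ∀ g : SignedParity d, g.support.card ≤ k → f.err D < g.err D + α}

/-- `∑_{j=1}^{k} (d choose j)`, the number of nonempty sets of at most `k` out of `d` elements. -/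
def chooseLE (d k : ℕ) : ℕ := ∑ j ∈ Finset.Icc 1 k, d.choose j

/-!
Fix a robustly private learner for `n` users. For a signed parity `v = (ℓ, b)` let `P_v` be the law
on `{±1}^{d+1}` of density `1 + 3α b χ_ℓ`, where `χ_ℓ(x) = x_{d+1} ∏_{j ∈ ℓ} x_j`, and let `D_v` be
the law of density `1 + 2α b χ_ℓ`. Under `D_v` the parity `v` has error `1/2 - α` and every other
signed parity has error at least `1/2`, so the learner must output exactly `v` (`eq_of_err_lt`).

The law `D_v` is the mixture `U/3 + 2 P_v/3` with the uniform law `U`. So the samples can be drawn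
by first coloring the users uniformly with three colors, color `0` meaning a sample from `U` and
the other colors a sample from `P_v` (`ShuffleProtocol.accept_mixture`). By symmetry between the
colors, color `0` is used at least `n/3` times with probability at least `1/3`
(`three_pow_le_card_colorings`). For such a coloring the uniform users already suffice for privacy.
Because of the shuffler only the number of uniform users matters; in the formalization this is the
fact that users can be absorbed into a symmetric test one by one and in any order
(`ShuffleProtocol.addUser_comm`, `ShuffleProtocol.accept_perm`).

Now replace the users with law `P_v` by uniform users one at a time. In each step at least `n/3`
users have data that do not depend on `v`, apart from one user with datum `x`, and the remaining
users and the analyzer only post-process the view `μ_x` of these users, by some test `φ_v`. Summed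
over `v`, the loss in success probability is `3α` times the mean over uniform `x` of `∫ G(x, ·) dμ_x`
with `G(x, r) = ∑_v b χ_ℓ(x) φ_v(r)`. For every `r`, `G(·, r)` has mean `0` and, by Parseval, second
moment at most `C`, the number of sets `ℓ`. Since `μ_x` is within `(ε, δ)` of a fixed law, the mean
is at most `(e^ε - 1) √C + 2 δ C` (`sum_integral_le_of_indistinguishable`,
`sum_accept_biasedLaw_cons_le`). On uniform data the success probabilities sum to at most `1` over
the `2C` signed parities. Comparing the two ends gives `n α ((e^ε - 1) √C + δ C) ≳ C`
(`card_le_mul_of_learns`), and the hypothesis on `δ` makes `δ C` of order `ε`.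
-/

/-! ### Symmetric tests of shuffled messages -/

namespace MsgSeq

variable {Y : Type v}

/-- Two sequences of messages are equivalent if they agree up to order, that is, if they carry
the same multiset of messages. -/
def Equivalent (s t : MsgSeq Y) : Prop := (List.ofFn s.2).Perm (List.ofFn t.2)

theorem ofFn_append (a b : MsgSeq Y) :
    List.ofFn (a.append b).2 = List.ofFn a.2 ++ List.ofFn b.2 := by
  change List.ofFn (Fin.append a.2 b.2) = _
  exact List.ofFn_fin_append _ _

theorem Equivalent.append_left {s t : MsgSeq Y} (h : s.Equivalent t) (a : MsgSeq Y) :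
    (a.append s).Equivalent (a.append t) := by
  unfold Equivalent
  rw [ofFn_append, ofFn_append]
  exact List.Perm.append_left _ h

theorem equivalent_append_left_comm (a b s : MsgSeq Y) :
    (a.append (b.append s)).Equivalent (b.append (a.append s)) := by
  unfold Equivalent
  simp only [ofFn_append, ← List.append_assoc]
  exact List.Perm.append_right _ List.perm_append_comm

theorem equivalent_permute (s : MsgSeq Y) (σ : Equiv.Perm (Fin s.1)) :
    (s.permute σ).Equivalent s :=
  σ.ofFn_comp_perm s.2

theorem Equivalent.exists_permute {s t : MsgSeq Y} (h : s.Equivalent t) :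
    ∃ σ : Equiv.Perm (Fin t.1), s = t.permute σ := by
  classical
  obtain ⟨m, f⟩ := s
  obtain ⟨k, g⟩ := t
  have hmk : m = k := by simpa using List.Perm.length_eq h
  subst hmk
  have hp : (List.ofFn f).Subperm (List.ofFn g) := List.Perm.subperm h
  let τ : Fin m → Fin m := fun i =>
    Fin.cast (List.length_ofFn) (hp.idxInj (Fin.cast (List.length_ofFn).symm i))
  have hτ : Function.Injective τ := by
    intro i j hij
    have := hp.idxInj_injective (Fin.cast_injective _ hij)
    exact Fin.cast_injective _ this
  refine ⟨Equiv.ofBijective τ (Finite.injective_iff_bijective.1 hτ), ?_⟩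
  change (⟨m, f⟩ : MsgSeq Y) = ⟨m, g ∘ τ⟩
  congr 1
  funext i
  have := hp.getElem_idxInj_eq_getElem (i := Fin.cast (List.length_ofFn).symm i)
  simp only [List.getElem_ofFn] at this
  exact this.symm

end MsgSeq

theorem lintegral_shuffler {Y : Type v} [MeasurableSpace Y] {f : MsgSeq Y → ℝ≥0∞}
    (hf : Measurable f) (s : MsgSeq Y) :
    ∫⁻ t, f t ∂(shuffler Y s) =
      ∑ σ : Equiv.Perm (Fin s.1), ((s.1 ! : ℕ) : ℝ≥0∞)⁻¹ * f (s.permute σ) := by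
  change ∫⁻ t, f t ∂(∑ σ : Equiv.Perm (Fin s.1),
    ((s.1 ! : ℕ) : ℝ≥0∞)⁻¹ • Measure.dirac (s.permute σ)) = _
  rw [lintegral_finsetSum_measure]
  refine Finset.sum_congr rfl fun σ _ => ?_
  rw [lintegral_smul_measure, lintegral_dirac' _ hf, smul_eq_mul]

theorem shuffler_permute {Y : Type v} [MeasurableSpace Y] (s : MsgSeq Y)
    (τ : Equiv.Perm (Fin s.1)) : shuffler Y (s.permute τ) = shuffler Y s := by
  change (∑ σ : Equiv.Perm (Fin s.1), ((s.1 ! : ℕ) : ℝ≥0∞)⁻¹ •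
    Measure.dirac ((s.permute τ).permute σ)) = ∑ σ : Equiv.Perm (Fin s.1),
    ((s.1 ! : ℕ) : ℝ≥0∞)⁻¹ • Measure.dirac (s.permute σ)
  exact Fintype.sum_equiv (Equiv.mulLeft τ) _ _ fun σ => rfl

/-- A statistical test of the public string and an unordered collection of messages: a measurable
`[0, 1]`-valued function that depends on the messages only up to their order. -/
@[ext]
structure SymTest (W : Type w) (Y : Type v) [MeasurableSpace W] [MeasurableSpace Y] where
  toFun : W → MsgSeq Y → ℝ≥0∞
  measurable : Measurable (Function.uncurry toFun)
  symm : ∀ w s t, MsgSeq.Equivalent s t → toFun w s = toFun w t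
  le_one : ∀ w s, toFun w s ≤ 1

namespace SymTest

variable {W : Type w} {Y : Type v} [MeasurableSpace W] [MeasurableSpace Y]

/-- The test that shuffles the messages and then draws from a kernel `κ`, accepting if the
result lies in `S`. -/
noncomputable def ofKernel {O : Type z} [MeasurableSpace O] (κ : Kernel (W × MsgSeq Y) O)
    [IsMarkovKernel κ] (S : Set O) (hS : MeasurableSet S) : SymTest W Y where
  toFun w s := ∫⁻ t, κ (w, t) S ∂(shuffler Y s)
  measurable := by
    let η : Kernel (W × MsgSeq Y) (MsgSeq Y) := (shuffler Y).comap Prod.snd measurable_snd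
    have : Measurable (fun p : W × MsgSeq Y => ∫⁻ t, κ (p.1, t) S ∂(η p)) := by
      refine Measurable.lintegral_kernel_prod_right'
        (f := fun q : (W × MsgSeq Y) × MsgSeq Y => κ (q.1.1, q.2) S) ?_
      exact (κ.measurable_coe hS).comp (by fun_prop)
    exact this
  symm w s t h := by
    obtain ⟨σ, rfl⟩ := h.exists_permute
    rw [shuffler_permute]
  le_one w s := by
    calc ∫⁻ t, κ (w, t) S ∂(shuffler Y s) ≤ ∫⁻ t, 1 ∂(shuffler Y s) :=
          lintegral_mono fun t => prob_le_one
      _ = 1 := by simp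

theorem lintegral_shuffler_eq (F : SymTest W Y) (w : W) (s : MsgSeq Y) :
    ∫⁻ t, F.toFun w t ∂(shuffler Y s) = F.toFun w s := by
  rw [lintegral_shuffler (F.measurable.of_uncurry_left)]
  have : ∀ σ : Equiv.Perm (Fin s.1), F.toFun w (s.permute σ) = F.toFun w s := fun σ =>
    F.symm _ _ _ (s.equivalent_permute σ)
  simp only [this, Finset.sum_const, Finset.card_univ, Fintype.card_perm, Fintype.card_fin,
    nsmul_eq_mul]
  rw [← mul_assoc, ENNReal.mul_inv_cancel (by exact_mod_cast s.1.factorial_ne_zero)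
    (ENNReal.natCast_ne_top _), one_mul]

end SymTest

namespace ShuffleProtocol

variable {X : Type u} {W : Type w} {Y : Type v} {O : Type z}
  [MeasurableSpace W] [MeasurableSpace Y] [MeasurableSpace O]

theorem lintegral_view (P : ShuffleProtocol X W Y O) (n h : ℕ) (x : Fin h → X)
    (F : SymTest W Y) :
    ∫⁻ p, F.toFun p.1 p.2 ∂(P.view n h x) =
      ∫⁻ w, ∫⁻ s, F.toFun w s ∂(P.messages n h x w) ∂P.coins := by
  unfold view
  rw [Measure.lintegral_compProd (f := fun p => F.toFun p.1 p.2) F.measurable]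
  refine lintegral_congr fun w => ?_
  rw [Kernel.lintegral_comp _ _ _ (F.measurable.of_uncurry_left)]
  exact lintegral_congr fun s => F.lintegral_shuffler_eq w s

theorem run_apply (P : ShuffleProtocol X W Y O) (n : ℕ) (x : Fin n → X) {S : Set O}
    (hS : MeasurableSet S) :
    P.run n x S =
      ∫⁻ p, (SymTest.ofKernel (P.analyzer n) S hS).toFun p.1 p.2 ∂(P.view n n x) := by
  rw [lintegral_view]
  unfold run view
  rw [Measure.bind_apply hS (Kernel.aemeasurable _),
    Measure.lintegral_compProd ((P.analyzer n).measurable_coe hS)]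
  refine lintegral_congr fun w => ?_
  have hm : Measurable fun t => P.analyzer n (w, t) S :=
    ((P.analyzer n).measurable_coe hS).comp measurable_prodMk_left
  rw [Kernel.lintegral_comp _ _ _ hm]
  rfl

theorem lintegral_messages_zero (P : ShuffleProtocol X W Y O) (n : ℕ) (x : Fin 0 → X)
    (F : SymTest W Y) (w : W) :
    ∫⁻ s, F.toFun w s ∂(P.messages n 0 x w) = F.toFun w MsgSeq.empty := by
  simp only [messages, Kernel.const_apply]
  exact lintegral_dirac' _ F.measurable.of_uncurry_left

theorem lintegral_messages_succ (P : ShuffleProtocol X W Y O) (n h : ℕ) (x : Fin (h + 1) → X)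
    (F : SymTest W Y) (w : W) :
    ∫⁻ s, F.toFun w s ∂(P.messages n (h + 1) x w) =
      ∫⁻ s, ∫⁻ a, F.toFun w (a.append s) ∂(P.randomizer n (x 0) w)
        ∂(P.messages n h (Fin.tail x) w) := by
  have hF : Measurable (F.toFun w) := F.measurable.of_uncurry_left
  simp only [messages]
  rw [Kernel.map_apply _ MsgSeq.measurable_append, lintegral_map hF MsgSeq.measurable_append,
    Kernel.lintegral_prod_symm _ _ _
      (show Measurable fun p : MsgSeq Y × MsgSeq Y => F.toFun w (p.1.append p.2) from
        hF.comp MsgSeq.measurable_append)]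

theorem measurable_lintegral_randomizer_append (P : ShuffleProtocol X W Y O) (n : ℕ) (x : X)
    (F : SymTest W Y) :
    Measurable (fun p : W × MsgSeq Y =>
      ∫⁻ a, F.toFun p.1 (a.append p.2) ∂(P.randomizer n x p.1)) := by
  let η : Kernel (W × MsgSeq Y) (MsgSeq Y) := (P.randomizer n x).comap Prod.fst measurable_fst
  have : Measurable (fun p : W × MsgSeq Y => ∫⁻ a, F.toFun p.1 (a.append p.2) ∂(η p)) := by
    refine Measurable.lintegral_kernel_prod_right'
      (f := fun q : (W × MsgSeq Y) × MsgSeq Y => F.toFun q.1.1 (q.2.append q.1.2)) ?_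
    have h : Measurable fun q : (W × MsgSeq Y) × MsgSeq Y => (q.1.1, q.2.append q.1.2) :=
      (measurable_fst.comp measurable_fst).prodMk
        (MsgSeq.measurable_append.comp
          (measurable_snd.prodMk (measurable_snd.comp measurable_fst)))
    exact F.measurable.comp h
  exact this

variable [Fintype X]

/-- The test that adds the messages of one more user, whose datum has law `p`, and then
applies `F`. -/
noncomputable def addUser (P : ShuffleProtocol X W Y O) (n : ℕ) (F : SymTest W Y) (p : PMF X) :
    SymTest W Y where
  toFun w s := ∑ x, p x * ∫⁻ a, F.toFun w (a.append s) ∂(P.randomizer n x w)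
  measurable := Finset.measurable_fun_sum _ fun x _ =>
    (P.measurable_lintegral_randomizer_append n x F).const_mul _
  symm w s t h := by
    refine Finset.sum_congr rfl fun x _ => ?_
    congr 1
    exact lintegral_congr fun a => F.symm _ _ _ (h.append_left a)
  le_one w s := by
    calc ∑ x, p x * ∫⁻ a, F.toFun w (a.append s) ∂(P.randomizer n x w)
        ≤ ∑ x, p x * 1 := by
          gcongr with x
          calc _ ≤ ∫⁻ a, 1 ∂(P.randomizer n x w) := lintegral_mono fun a => F.le_one _ _
            _ = 1 := by simp
      _ = 1 := by simp only [mul_one]; rw [← tsum_fintype (L := .unconditional _), p.tsum_coe]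

/-- Users can be added in either order. -/
theorem addUser_comm (P : ShuffleProtocol X W Y O) (n : ℕ) (F : SymTest W Y) (p q : PMF X) :
    P.addUser n (P.addUser n F p) q = P.addUser n (P.addUser n F q) p := by
  ext w s
  have hmeas : ∀ x : X, Measurable fun a : MsgSeq Y =>
      ∫⁻ b, F.toFun w (b.append (a.append s)) ∂(P.randomizer n x w) := fun x =>
    (P.measurable_lintegral_randomizer_append n x F).comp
      (measurable_const.prodMk (MsgSeq.measurable_append.comp
        (measurable_id.prodMk measurable_const)))
  have expand : ∀ p q : PMF X, (P.addUser n (P.addUser n F p) q).toFun w s =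
      ∑ y, ∑ x, q y * (p x * ∫⁻ a, ∫⁻ b, F.toFun w (b.append (a.append s))
        ∂(P.randomizer n x w) ∂(P.randomizer n y w)) := by
    intro p q
    simp only [addUser]
    refine Finset.sum_congr rfl fun y _ => ?_
    rw [lintegral_finsetSum _ fun x _ => (hmeas x).const_mul _, Finset.mul_sum]
    refine Finset.sum_congr rfl fun x _ => ?_
    rw [lintegral_const_mul _ (hmeas x)]
  rw [expand, expand, Finset.sum_comm]
  refine Finset.sum_congr rfl fun x _ => Finset.sum_congr rfl fun y _ => ?_
  rw [mul_left_comm]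
  congr 2
  rw [lintegral_lintegral_swap]
  · refine lintegral_congr fun b => lintegral_congr fun a => ?_
    exact F.symm _ _ _ (MsgSeq.equivalent_append_left_comm _ _ _)
  · refine ((F.measurable.of_uncurry_left (x := w)).comp (g := F.toFun w)
      (MsgSeq.measurable_append.comp (measurable_snd.prodMk
        (MsgSeq.measurable_append.comp
          (measurable_fst.prodMk measurable_const))))).aemeasurable

/-- The acceptance probability of `F` when there are no messages at all. -/
noncomputable def evalEmpty (P : ShuffleProtocol X W Y O) (F : SymTest W Y) : ℝ≥0∞ :=
  ∫⁻ w, F.toFun w MsgSeq.empty ∂P.coins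

/-- The acceptance probability of `F` on the messages of users whose data are drawn independently
from the laws in the list `l`. -/
noncomputable def accept (P : ShuffleProtocol X W Y O) (n : ℕ) (F : SymTest W Y)
    (l : List (PMF X)) : ℝ≥0∞ :=
  P.evalEmpty (l.foldl (P.addUser n) F)

theorem accept_cons (P : ShuffleProtocol X W Y O) (n : ℕ) (F : SymTest W Y) (p : PMF X)
    (l : List (PMF X)) : P.accept n F (p :: l) = P.accept n (P.addUser n F p) l := rfl

theorem accept_append (P : ShuffleProtocol X W Y O) (n : ℕ) (F : SymTest W Y)
    (l l' : List (PMF X)) :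
    P.accept n F (l ++ l') = P.accept n (l.foldl (P.addUser n) F) l' := by
  simp only [accept, List.foldl_append]

theorem accept_perm (P : ShuffleProtocol X W Y O) (n : ℕ) (F : SymTest W Y)
    {l l' : List (PMF X)} (h : l.Perm l') : P.accept n F l = P.accept n F l' := by
  unfold accept
  rw [h.foldl_eq' (fun p _ q _ F => P.addUser_comm n F p q)]

theorem accept_le_one (P : ShuffleProtocol X W Y O) (n : ℕ) (F : SymTest W Y)
    (l : List (PMF X)) : P.accept n F l ≤ 1 := by
  unfold accept evalEmpty
  calc _ ≤ ∫⁻ w, 1 ∂P.coins := lintegral_mono fun w => SymTest.le_one _ _ _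
    _ = 1 := by simp

/-- The acceptance probability as an average over datasets. -/
theorem accept_ofFn (P : ShuffleProtocol X W Y O) (n : ℕ) :
    ∀ (h : ℕ) (p : Fin h → PMF X) (F : SymTest W Y), P.accept n F (List.ofFn p) =
      ∑ x : Fin h → X, (∏ i, p i (x i)) * ∫⁻ r, F.toFun r.1 r.2 ∂(P.view n h x)
  | 0, p, F => by
    simp only [lintegral_view, lintegral_messages_zero]
    simp [accept, evalEmpty]
  | h + 1, p, F => by
    rw [List.ofFn_succ, accept_cons, accept_ofFn P n h]
    rw [← (Fin.consEquiv fun _ => X).sum_comp, Fintype.sum_prod_type_right]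
    refine Finset.sum_congr rfl fun y _ => ?_
    simp only [lintegral_view, lintegral_messages_succ]
    have hm : ∀ x : X, Measurable fun q : W × MsgSeq Y => p 0 x *
        ∫⁻ a, F.toFun q.1 (a.append q.2) ∂(P.randomizer n x q.1) := fun x =>
      (P.measurable_lintegral_randomizer_append n x F).const_mul _
    have hm' : ∀ x : X, Measurable fun w : W => ∫⁻ s,
        ∫⁻ a, F.toFun w (a.append s) ∂(P.randomizer n x w) ∂(P.messages n h y w) := fun x =>
      Measurable.lintegral_kernel_prod_right'
        (P.measurable_lintegral_randomizer_append n x F)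
    have key : ∫⁻ w, ∫⁻ s, (P.addUser n F (p 0)).toFun w s ∂(P.messages n h y w) ∂P.coins =
        ∑ x, p 0 x * ∫⁻ w, ∫⁻ s, ∫⁻ a, F.toFun w (a.append s) ∂(P.randomizer n x w)
          ∂(P.messages n h y w) ∂P.coins := by
      have : ∀ w, ∫⁻ s, (P.addUser n F (p 0)).toFun w s ∂(P.messages n h y w) =
          ∑ x, p 0 x * ∫⁻ s, ∫⁻ a, F.toFun w (a.append s) ∂(P.randomizer n x w)
            ∂(P.messages n h y w) := by
        intro w
        simp only [addUser]
        have hmw : ∀ x : X, Measurable fun s => p 0 x *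
            ∫⁻ a, F.toFun w (a.append s) ∂(P.randomizer n x w) := fun x =>
          (hm x).comp measurable_prodMk_left
        rw [lintegral_finsetSum _ fun x _ => hmw x]
        refine Finset.sum_congr rfl fun x _ => ?_
        rw [lintegral_const_mul]
        exact (P.measurable_lintegral_randomizer_append n x F).comp measurable_prodMk_left
      simp only [this]
      rw [lintegral_finsetSum _ fun x _ => (hm' x).const_mul _]
      exact Finset.sum_congr rfl fun x _ => lintegral_const_mul _ (hm' x)
    rw [key, Finset.mul_sum]
    refine Finset.sum_congr rfl fun x _ => ?_
    rw [Fin.prod_univ_succ, ← mul_assoc, mul_comm (∏ i, p _ _)]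
    rfl

end ShuffleProtocol

/-! ### Expectations under indistinguishable laws -/

/-- A multiplicative and additive comparison of measures on sets passes to integrals of functions
with values in `[0, M]`, by the layer cake formula. -/
theorem integral_le_of_measure_le {R : Type z} [MeasurableSpace R] {μ ν : Measure R}
    [IsProbabilityMeasure μ] [IsProbabilityMeasure ν] {ε δ M : ℝ} (hδ : 0 ≤ δ) (hM : 0 ≤ M)
    (h : ∀ S, MeasurableSet S →
      μ S ≤ ENNReal.ofReal (Real.exp ε) * ν S + ENNReal.ofReal δ)
    {f : R → ℝ} (hf : Measurable f) (h0 : ∀ r, 0 ≤ f r) (hfM : ∀ r, f r ≤ M) :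
    ∫ r, f r ∂μ ≤ Real.exp ε * ∫ r, f r ∂ν + δ * M := by
  have layer : ∀ (ρ : Measure R) [IsProbabilityMeasure ρ],
      ∫⁻ r, ENNReal.ofReal (f r) ∂ρ = ∫⁻ t in Set.Ioc 0 M, ρ {r | t < f r} := by
    intro ρ _
    rw [lintegral_eq_lintegral_meas_lt ρ (Filter.Eventually.of_forall h0) hf.aemeasurable,
      ← Set.Ioc_union_Ioi_eq_Ioi hM, lintegral_union measurableSet_Ioi Set.Ioc_disjoint_Ioi_same]
    have : ∫⁻ t in Set.Ioi M, ρ {r | t < f r} = 0 := by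
      rw [setLIntegral_congr_fun measurableSet_Ioi (g := fun _ => 0), lintegral_zero]
      intro t ht
      have : {r | t < f r} = ∅ := by
        ext r
        simpa using (hfM r).trans (le_of_lt ht)
      simp [this]
    rw [this, add_zero]
  have hint : ∀ (ρ : Measure R) [IsProbabilityMeasure ρ], Integrable f ρ := fun ρ _ =>
    Integrable.of_bound hf.aestronglyMeasurable M
      (Filter.Eventually.of_forall fun r => by
        rw [Real.norm_eq_abs, abs_of_nonneg (h0 r)]; exact hfM r)
  have key : ∫⁻ r, ENNReal.ofReal (f r) ∂μ ≤ ENNReal.ofReal (Real.exp ε) *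
      ∫⁻ r, ENNReal.ofReal (f r) ∂ν + ENNReal.ofReal δ * ENNReal.ofReal M := by
    have hanti : Antitone fun t : ℝ => ν {r | t < f r} := fun s t hst =>
      measure_mono fun r (hr : t < f r) => lt_of_le_of_lt hst hr
    rw [layer μ, layer ν]
    calc ∫⁻ t in Set.Ioc 0 M, μ {r | t < f r}
        ≤ ∫⁻ t in Set.Ioc 0 M,
            (ENNReal.ofReal (Real.exp ε) * ν {r | t < f r} + ENNReal.ofReal δ) :=
          lintegral_mono fun t => h _ (measurableSet_lt measurable_const hf)
      _ = _ := by
          rw [lintegral_add_right _ measurable_const, lintegral_const_mul _ hanti.measurable,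
            setLIntegral_const, Real.volume_Ioc, sub_zero]
  rw [← ofReal_integral_eq_lintegral_ofReal (hint μ) (Filter.Eventually.of_forall h0),
    ← ofReal_integral_eq_lintegral_ofReal (hint ν) (Filter.Eventually.of_forall h0),
    ← ENNReal.ofReal_mul (Real.exp_pos _).le, ← ENNReal.ofReal_mul hδ,
    ← ENNReal.ofReal_add (mul_nonneg (Real.exp_pos _).le (integral_nonneg h0))
      (mul_nonneg hδ hM)] at key
  exact (ENNReal.ofReal_le_ofReal_iff (add_nonneg (mul_nonneg (Real.exp_pos _).le
    (integral_nonneg h0)) (mul_nonneg hδ hM))).1 key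

/-- If two laws are `(ε, δ)`-indistinguishable, the expectations of a bounded function of either
sign differ by a multiplicative error on its absolute value and an additive error. -/
theorem integral_sub_le_of_indistinguishable {R : Type z} [MeasurableSpace R] {μ ν : Measure R}
    [IsProbabilityMeasure μ] [IsProbabilityMeasure ν] {ε δ M : ℝ} (hε : 0 ≤ ε) (hδ : 0 ≤ δ)
    (hM : 0 ≤ M)
    (h : ∀ S, MeasurableSet S →
      μ S ≤ ENNReal.ofReal (Real.exp ε) * ν S + ENNReal.ofReal δ)
    (h' : ∀ S, MeasurableSet S →
      ν S ≤ ENNReal.ofReal (Real.exp ε) * μ S + ENNReal.ofReal δ)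
    {g : R → ℝ} (hg : Measurable g) (hgM : ∀ r, |g r| ≤ M) :
    ∫ r, g r ∂μ - ∫ r, g r ∂ν ≤ (Real.exp ε - 1) * ∫ r, |g r| ∂ν + 2 * δ * M := by
  have hp : Measurable fun r => max (g r) 0 := hg.max measurable_const
  have hn : Measurable fun r => max (-g r) 0 := hg.neg.max measurable_const
  have hpM : ∀ r, max (g r) 0 ≤ M := fun r => max_le ((le_abs_self _).trans (hgM r)) hM
  have hnM : ∀ r, max (-g r) 0 ≤ M := fun r => max_le ((neg_le_abs _).trans (hgM r)) hM
  have hint : ∀ (ρ : Measure R) [IsProbabilityMeasure ρ] (f : R → ℝ), Measurable f →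
      (∀ r, 0 ≤ f r) → (∀ r, f r ≤ M) → Integrable f ρ := fun ρ _ f hf h0 hfM =>
    Integrable.of_bound hf.aestronglyMeasurable M
      (Filter.Eventually.of_forall fun r => by
        rw [Real.norm_eq_abs, abs_of_nonneg (h0 r)]; exact hfM r)
  have split : ∀ (ρ : Measure R) [IsProbabilityMeasure ρ],
      ∫ r, g r ∂ρ = ∫ r, max (g r) 0 ∂ρ - ∫ r, max (-g r) 0 ∂ρ := by
    intro ρ _
    rw [← integral_sub (hint ρ _ hp (fun r => le_max_right _ _) hpM)
      (hint ρ _ hn (fun r => le_max_right _ _) hnM)]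
    exact integral_congr_ae (Filter.Eventually.of_forall fun r =>
      (max_zero_sub_max_neg_zero_eq_self (g r)).symm)
  have splitAbs : ∫ r, |g r| ∂ν = ∫ r, max (g r) 0 ∂ν + ∫ r, max (-g r) 0 ∂ν := by
    rw [← integral_add (hint ν _ hp (fun r => le_max_right _ _) hpM)
      (hint ν _ hn (fun r => le_max_right _ _) hnM)]
    exact integral_congr_ae (Filter.Eventually.of_forall fun r =>
      (max_zero_add_max_neg_zero_eq_abs_self (g r)).symm)
  have h1 := integral_le_of_measure_le hδ hM h hp (fun r => le_max_right _ _) hpM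
  have h2 := integral_le_of_measure_le hδ hM h' hn (fun r => le_max_right _ _) hnM
  rw [split μ, split ν, splitAbs]
  set a := ∫ r, max (g r) 0 ∂μ
  set b := ∫ r, max (-g r) 0 ∂μ with hb
  set a' := ∫ r, max (g r) 0 ∂ν
  set b' := ∫ r, max (-g r) 0 ∂ν
  have hb0 : 0 ≤ b := integral_nonneg fun r => le_max_right _ _
  have he : 1 ≤ Real.exp ε := Real.one_le_exp hε
  have hb'0 : 0 ≤ b' := integral_nonneg fun r => le_max_right _ _
  have hδM : 0 ≤ δ * M := mul_nonneg hδ hM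
  -- `b' - b ≤ (1 - e^{-ε}) b' + e^{-ε} δ M`, and `1 - e^{-ε} ≤ e^ε - 1`.
  have h3 : b' - b ≤ (Real.exp ε - 1) * b' + δ * M := by
    by_cases hbb : b ≤ b'
    · nlinarith
    · nlinarith [mul_nonneg (sub_nonneg.2 he) hb'0]
  nlinarith

/-- A family of pairwise `(ε, δ)`-indistinguishable laws indexed by a finite set cannot correlate
with functions `G x` that average to `0` over the index and have small second moment. -/
theorem sum_integral_le_of_indistinguishable {X : Type u} [Fintype X] {R : Type z}
    [MeasurableSpace R] (μ : X → Measure R) [∀ x, IsProbabilityMeasure (μ x)] {ε δ M K : ℝ}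
    (hε : 0 ≤ ε) (hδ : 0 ≤ δ) (hM : 0 ≤ M) (hK : 0 ≤ K)
    (h : ∀ x x' S, MeasurableSet S →
      μ x S ≤ ENNReal.ofReal (Real.exp ε) * μ x' S + ENNReal.ofReal δ)
    (G : X → R → ℝ) (hG : ∀ x, Measurable (G x)) (hGM : ∀ x r, |G x r| ≤ M)
    (hG0 : ∀ r, ∑ x, G x r = 0)
    (hG2 : ∀ r, ∑ x, G x r ^ 2 ≤ Fintype.card X * K ^ 2) :
    ∑ x, ∫ r, G x r ∂(μ x) ≤ Fintype.card X * ((Real.exp ε - 1) * K + 2 * δ * M) := by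
  cases isEmpty_or_nonempty X with
  | inl hX => simp
  | inr hX =>
    obtain ⟨x₀⟩ := hX
    have hint : ∀ x, Integrable (G x) (μ x₀) := fun x =>
      Integrable.of_bound (hG x).aestronglyMeasurable M (Filter.Eventually.of_forall (hGM x))
    have hzero : ∑ x, ∫ r, G x r ∂(μ x₀) = 0 := by
      rw [← integral_finsetSum _ fun x _ => hint x]
      simp [hG0]
    have habs : ∑ x, ∫ r, |G x r| ∂(μ x₀) ≤ Fintype.card X * K := by
      rw [← integral_finsetSum _ fun x _ => (hint x).abs]
      have : ∀ r, ∑ x, |G x r| ≤ Fintype.card X * K := by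
        intro r
        refine abs_le_of_sq_le_sq' ?_ (by positivity) |>.2
        calc (∑ x, |G x r|) ^ 2 ≤ (Fintype.card X : ℝ) * ∑ x, |G x r| ^ 2 := by
              simpa using sq_sum_le_card_mul_sum_sq (s := Finset.univ) (f := fun x => |G x r|)
          _ ≤ Fintype.card X * (Fintype.card X * K ^ 2) := by
              gcongr
              simpa using hG2 r
          _ = _ := by ring
      calc ∫ r, ∑ x, |G x r| ∂(μ x₀) ≤ ∫ r, (Fintype.card X * K : ℝ) ∂(μ x₀) :=
            integral_mono (integrable_finsetSum _ fun x _ => (hint x).abs)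
              (integrable_const _) this
        _ = _ := by simp
    calc ∑ x, ∫ r, G x r ∂(μ x)
        = ∑ x, (∫ r, G x r ∂(μ x) - ∫ r, G x r ∂(μ x₀)) := by
          rw [Finset.sum_sub_distrib, hzero, sub_zero]
      _ ≤ ∑ x, ((Real.exp ε - 1) * ∫ r, |G x r| ∂(μ x₀) + 2 * δ * M) :=
          Finset.sum_le_sum fun x _ => integral_sub_le_of_indistinguishable hε hδ hM
            (h x x₀) (h x₀ x) (hG x) (hGM x)
      _ = (Real.exp ε - 1) * ∑ x, ∫ r, |G x r| ∂(μ x₀) + Fintype.card X * (2 * δ * M) := by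
          rw [Finset.sum_add_distrib, Finset.mul_sum]; simp
      _ ≤ (Real.exp ε - 1) * (Fintype.card X * K) + Fintype.card X * (2 * δ * M) := by
          have := Real.one_le_exp hε
          gcongr
      _ = _ := by ring

/-! ### Characters and biased laws on the cube -/

/-- The character `x ↦ x_{d+1} ∏_{j ∈ ℓ} x_j` of `{±1}^{d+1}`: it is `1` where the parity of `ℓ`
predicts the label and `-1` elsewhere. -/
def character {d : ℕ} (l : Finset (Fin d)) (x : Example d) : ℝ :=
  ((x (Fin.last d) * ∏ j ∈ l, x j.castSucc : ℤˣ) : ℤ)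

theorem Int.units_cast_sq (u : ℤˣ) : ((u : ℤ) : ℝ) ^ 2 = 1 := by
  obtain rfl | rfl := Int.units_eq_one_or u <;> simp

theorem Int.units_abs_cast (u : ℤˣ) : |((u : ℤ) : ℝ)| = 1 := by
  obtain rfl | rfl := Int.units_eq_one_or u <;> simp

theorem character_sq {d : ℕ} (l : Finset (Fin d)) (x : Example d) : character l x ^ 2 = 1 :=
  Int.units_cast_sq _

theorem abs_character {d : ℕ} (l : Finset (Fin d)) (x : Example d) : |character l x| = 1 :=
  Int.units_abs_cast _

/-- Negation of one coordinate. -/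
def flipAt {d : ℕ} (j : Fin (d + 1)) (x : Example d) : Example d :=
  Function.update x j (-x j)

theorem flipAt_involutive {d : ℕ} (j : Fin (d + 1)) :
    Function.Involutive (flipAt (d := d) j) := by
  intro x
  simp [flipAt]

theorem sum_eq_zero_of_flipAt {d : ℕ} (j : Fin (d + 1)) (f : Example d → ℝ)
    (h : ∀ x, f (flipAt j x) = -f x) : ∑ x, f x = 0 := by
  have h1 : ∑ x, f (flipAt j x) = ∑ x, f x :=
    Equiv.sum_comp (Function.Involutive.toPerm _ (flipAt_involutive j)) f
  simp only [h, Finset.sum_neg_distrib] at h1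
  linarith

theorem prod_flipAt {d : ℕ} (l : Finset (Fin d)) (j : Fin d) (x : Example d) :
    ∏ i ∈ l, flipAt j.castSucc x i.castSucc =
      (if j ∈ l then -1 else 1) * ∏ i ∈ l, x i.castSucc := by
  have : ∀ i : Fin d, flipAt j.castSucc x i.castSucc =
      (if i = j then -1 else 1) * x i.castSucc := by
    intro i
    by_cases hij : i = j
    · subst hij; simp [flipAt]
    · simp [flipAt, hij]
  simp only [this, Finset.prod_mul_distrib, Finset.prod_ite_eq']

theorem character_flipAt_castSucc {d : ℕ} (l : Finset (Fin d)) (j : Fin d) (x : Example d) :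
    character l (flipAt j.castSucc x) = (if j ∈ l then -1 else 1) * character l x := by
  have hlast : flipAt j.castSucc x (Fin.last d) = x (Fin.last d) :=
    Function.update_of_ne (Fin.castSucc_lt_last j).ne' _ _
  unfold character
  rw [prod_flipAt, hlast]
  split_ifs <;> simp

theorem character_flipAt_last {d : ℕ} (l : Finset (Fin d)) (x : Example d) :
    character l (flipAt (Fin.last d) x) = -character l x := by
  have h : ∀ i : Fin d, flipAt (Fin.last d) x i.castSucc = x i.castSucc := fun i =>
    Function.update_of_ne (Fin.castSucc_lt_last i).ne _ _
  simp [character, h]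
  simp [flipAt]

theorem sum_character {d : ℕ} (l : Finset (Fin d)) : ∑ x, character l x = 0 :=
  sum_eq_zero_of_flipAt _ _ (character_flipAt_last l)

theorem sum_character_mul_of_ne {d : ℕ} {l l' : Finset (Fin d)} (h : l ≠ l') :
    ∑ x, character l x * character l' x = 0 := by
  have : ∃ j, ¬ (j ∈ l ↔ j ∈ l') := by
    by_contra! hc
    exact h (Finset.ext hc)
  obtain ⟨j, hj⟩ := this
  refine sum_eq_zero_of_flipAt j.castSucc _ fun x => ?_
  rw [character_flipAt_castSucc, character_flipAt_castSucc]
  by_cases h1 : j ∈ l <;> by_cases h2 : j ∈ l' <;> simp_all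

theorem sum_character_mul {d : ℕ} (l l' : Finset (Fin d)) :
    ∑ x, character l x * character l' x = if l = l' then (Fintype.card (Example d) : ℝ) else 0 := by
  split_ifs with h
  · subst h
    simp [← sq, character_sq]
  · exact sum_character_mul_of_ne h

/-- Parseval's identity for combinations of the characters. -/
theorem sum_sq_sum_character {d : ℕ} (L : Finset (Finset (Fin d))) (a : Finset (Fin d) → ℝ) :
    ∑ x, (∑ l ∈ L, a l * character l x) ^ 2 = Fintype.card (Example d) * ∑ l ∈ L, a l ^ 2 := by
  calc ∑ x, (∑ l ∈ L, a l * character l x) ^ 2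
      = ∑ x, ∑ l ∈ L, ∑ l' ∈ L, a l * a l' * (character l x * character l' x) := by
        refine Finset.sum_congr rfl fun x _ => ?_
        rw [sq, Finset.sum_mul_sum]
        refine Finset.sum_congr rfl fun l _ => Finset.sum_congr rfl fun l' _ => ?_
        ring
    _ = ∑ l ∈ L, ∑ l' ∈ L, a l * a l' * ∑ x, character l x * character l' x := by
        rw [Finset.sum_comm]
        refine Finset.sum_congr rfl fun l _ => ?_
        rw [Finset.sum_comm]
        simp only [Finset.mul_sum]
    _ = _ := by
        rw [Finset.mul_sum]
        refine Finset.sum_congr rfl fun l hl => ?_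
        simp only [sum_character_mul, mul_ite, mul_zero, Finset.sum_ite_eq, hl, if_true]
        ring

theorem one_add_mul_character_nonneg {d : ℕ} (l : Finset (Fin d)) (b : ℤˣ) {β : ℝ}
    (hβ : |β| ≤ 1) (x : Example d) : 0 ≤ 1 + β * (b : ℤ) * character l x := by
  have : |β * (b : ℤ) * character l x| ≤ 1 := by
    rw [abs_mul, abs_mul, abs_character, Int.units_abs_cast]; simpa using hβ
  linarith [neg_le_of_abs_le this]

/-- The law on `{±1}^{d+1}` whose density with respect to the uniform law is
`1 + β b x_{d+1} ∏_{j ∈ ℓ} x_j`: the attributes are uniform, and the label agrees with the signed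
parity `(ℓ, b)` with probability `(1 + β) / 2`. -/
noncomputable def biasedLaw {d : ℕ} (l : Finset (Fin d)) (b : ℤˣ) (β : ℝ) (hβ : |β| ≤ 1) :
    PMF (Example d) :=
  PMF.ofFintype
    (fun x => ENNReal.ofReal ((1 + β * (b : ℤ) * character l x) / Fintype.card (Example d))) <| by
    rw [← ENNReal.ofReal_sum_of_nonneg fun x _ =>
      div_nonneg (one_add_mul_character_nonneg l b hβ x) (Nat.cast_nonneg _),
      ← Finset.sum_div, Finset.sum_add_distrib, ← Finset.mul_sum, sum_character]
    have : (Fintype.card (Example d) : ℝ) ≠ 0 := Nat.cast_ne_zero.2 Fintype.card_ne_zero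
    simp only [Finset.sum_const, Finset.card_univ, nsmul_eq_mul, mul_one, mul_zero, add_zero]
    rw [div_self this, ENNReal.ofReal_one]

theorem biasedLaw_toReal {d : ℕ} (l : Finset (Fin d)) (b : ℤˣ) {β : ℝ} (hβ : |β| ≤ 1)
    (x : Example d) : (biasedLaw l b β hβ x).toReal =
      (1 + β * (b : ℤ) * character l x) / Fintype.card (Example d) := by
  rw [biasedLaw, PMF.ofFintype_apply, ENNReal.toReal_ofReal]
  exact div_nonneg (one_add_mul_character_nonneg l b hβ x) (Nat.cast_nonneg _)

theorem uniform_toReal {d : ℕ} (x : Example d) :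
    (PMF.uniformOfFintype (Example d) x).toReal = 1 / Fintype.card (Example d) := by
  simp

/-- The law of bias `2α` is the mixture of the uniform law and of the law of bias `3α` with
weights `1/3` and `2/3`. The mixture is written as a sum over three equally likely colors. -/
theorem biasedLaw_eq_mixture {d : ℕ} (l : Finset (Fin d)) (b : ℤˣ) {α : ℝ}
    (h2 : |2 * α| ≤ 1) (h3 : |3 * α| ≤ 1) (x : Example d) :
    biasedLaw l b (2 * α) h2 x = ∑ c : Fin 3, (3 : ℝ≥0∞)⁻¹ *
      (if c = 0 then PMF.uniformOfFintype (Example d) else biasedLaw l b (3 * α) h3) x := by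
  have hfin : ∀ c : Fin 3, (3 : ℝ≥0∞)⁻¹ *
      (if c = 0 then PMF.uniformOfFintype (Example d) else biasedLaw l b (3 * α) h3) x ≠ ⊤ :=
    fun c => ENNReal.mul_ne_top (by simp) (PMF.apply_ne_top _ _)
  rw [← ENNReal.toReal_eq_toReal_iff' (PMF.apply_ne_top _ _)
    (ENNReal.sum_ne_top.2 fun c _ => hfin c), ENNReal.toReal_sum fun c _ => hfin c]
  simp only [ENNReal.toReal_mul, Fin.sum_univ_three]
  simp only [if_true, if_neg (show (1 : Fin 3) ≠ 0 by decide),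
    if_neg (show (2 : Fin 3) ≠ 0 by decide), biasedLaw_toReal, uniform_toReal]
  simp only [ENNReal.toReal_inv, ENNReal.toReal_ofNat]
  ring

/-- The error of a signed parity in terms of its correlation with the label. -/
theorem SignedParity.err_eq {d : ℕ} (D : PMF (Example d)) (f : SignedParity d) :
    f.err D = ∑ x, (1 - (f.sign : ℤ) * character f.support x) / 2 * (D x).toReal := by
  classical
  unfold SignedParity.err
  rw [Finset.sum_filter]
  refine Finset.sum_congr rfl fun x _ => ?_
  unfold SignedParity.predict character
  generalize ∏ j ∈ f.support, x j.castSucc = p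
  generalize x (Fin.last d) = y
  generalize f.sign = b
  obtain rfl | rfl := Int.units_eq_one_or p <;> obtain rfl | rfl := Int.units_eq_one_or y <;>
    obtain rfl | rfl := Int.units_eq_one_or b <;> simp

theorem SignedParity.err_biasedLaw {d : ℕ} (l : Finset (Fin d)) (b : ℤˣ) {β : ℝ} (hβ : |β| ≤ 1)
    (f : SignedParity d) : f.err (biasedLaw l b β hβ) =
      (1 - β * if f.support = l then ((f.sign * b : ℤˣ) : ℤ) else 0) / 2 := by
  have hN : (Fintype.card (Example d) : ℝ) ≠ 0 := Nat.cast_ne_zero.2 Fintype.card_ne_zero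
  rw [SignedParity.err_eq]
  simp only [biasedLaw_toReal]
  have : ∀ x : Example d, (1 - (f.sign : ℤ) * character f.support x) / 2 *
      ((1 + β * (b : ℤ) * character l x) / Fintype.card (Example d)) =
      (1 + (β * (b : ℤ) * character l x - (f.sign : ℤ) * character f.support x
        - β * (b : ℤ) * (f.sign : ℤ) * (character f.support x * character l x))) *
        (1 / (2 * Fintype.card (Example d))) := fun x => by
    field_simp
    ring
  simp only [this]
  rw [← Finset.sum_mul, Finset.sum_add_distrib, Finset.sum_sub_distrib, Finset.sum_sub_distrib,
    ← Finset.mul_sum, ← Finset.mul_sum, ← Finset.mul_sum, sum_character, sum_character,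
    sum_character_mul]
  split_ifs with h
  · simp only [Finset.sum_const, Finset.card_univ, nsmul_eq_mul, Units.val_mul, Int.cast_mul]
    field_simp
    ring
  · simp only [Finset.sum_const, Finset.card_univ, nsmul_eq_mul]
    field_simp
    simp

/-- Under the law of bias `2α`, the planted signed parity is the only one with error less than the
optimum plus `α`. -/
theorem eq_of_err_lt {d : ℕ} (l : Finset (Fin d)) (b : ℤˣ) {α : ℝ} (hα : 0 < α)
    (h2 : |2 * α| ≤ 1) (f : SignedParity d)
    (h : f.err (biasedLaw l b (2 * α) h2) <
      (SignedParity.mk l b).err (biasedLaw l b (2 * α) h2) + α) : f = ⟨l, b⟩ := by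
  rw [SignedParity.err_biasedLaw, SignedParity.err_biasedLaw] at h
  obtain ⟨l', b'⟩ := f
  simp only [if_true] at h
  by_cases hl : l' = l
  · subst hl
    obtain rfl | rfl := Int.units_eq_one_or b' <;> obtain rfl | rfl := Int.units_eq_one_or b
    · rfl
    · simp at h; linarith
    · simp at h; linarith
    · rfl
  · rw [if_neg hl, ← sq, Int.units_sq] at h
    simp at h
    linarith

/-- The nonempty sets of at most `k` coordinates. -/
def supports (d k : ℕ) : Finset (Finset (Fin d)) :=
  (Finset.Icc 1 k).biUnion fun j => Finset.powersetCard j Finset.univ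

theorem card_supports (d k : ℕ) : (supports d k).card = chooseLE d k := by
  unfold supports chooseLE
  rw [Finset.card_biUnion]
  · simp
  · intro i _ j _ hij
    exact Finset.pairwise_disjoint_powersetCard _ hij

theorem card_le_of_mem_supports {d k : ℕ} {l : Finset (Fin d)} (h : l ∈ supports d k) :
    l.card ≤ k := by
  simp only [supports, Finset.mem_biUnion, Finset.mem_Icc, Finset.mem_powersetCard] at h
  obtain ⟨j, hj, -, rfl⟩ := h
  exact hj.2

theorem one_le_chooseLE {d k : ℕ} (hk : 1 ≤ k) (hkd : k ≤ d) : 1 ≤ chooseLE d k := by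
  have h1 : d.choose 1 ≤ chooseLE d k :=
    Finset.single_le_sum (f := fun j => d.choose j) (fun _ _ => Nat.zero_le _)
      (Finset.mem_Icc.2 ⟨le_rfl, hk⟩)
  rw [Nat.choose_one_right] at h1
  omega

theorem two_pow_le_two_mul_chooseLE {d : ℕ} (hd : 1 ≤ d) : 2 ^ d ≤ 2 * chooseLE d d := by
  have h : 2 ^ d = chooseLE d d + 1 := by
    rw [← Nat.sum_range_choose, Finset.sum_range_succ', Nat.choose_zero_right, chooseLE]
    congr 1
    rw [Finset.range_eq_Ico, Finset.sum_Ico_add' (fun j => d.choose j) 0 d 1]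
    rfl
  have := one_le_chooseLE hd le_rfl
  omega

/-! ### Acceptance probabilities as averages -/

theorem PMF.sum_prod_pi {X : Type u} [Fintype X] {h : ℕ} (p : Fin h → PMF X) :
    ∑ x : Fin h → X, ∏ i, p i (x i) = 1 := by
  classical
  have := Finset.prod_univ_sum (fun _ : Fin h => (Finset.univ : Finset X)) fun i x => p i x
  rw [Fintype.piFinset_univ] at this
  rw [← this]
  refine Finset.prod_eq_one fun i _ => ?_
  rw [← tsum_fintype (L := .unconditional _), (p i).tsum_coe]

namespace SymTest

variable {W : Type w} {Y : Type v} [MeasurableSpace W] [MeasurableSpace Y]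

theorem ne_top (F : SymTest W Y) (a : W) (s : MsgSeq Y) : F.toFun a s ≠ ⊤ :=
  ((F.le_one a s).trans_lt ENNReal.one_lt_top).ne

theorem toReal_le_one (F : SymTest W Y) (a : W) (s : MsgSeq Y) : (F.toFun a s).toReal ≤ 1 :=
  ENNReal.toReal_le_of_le_ofReal zero_le_one (by simpa using F.le_one a s)

theorem measurable_toReal (F : SymTest W Y) :
    Measurable fun r : W × MsgSeq Y => (F.toFun r.1 r.2).toReal :=
  F.measurable.ennreal_toReal

theorem integrable_toReal (F : SymTest W Y) (μ : Measure (W × MsgSeq Y))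
    [IsProbabilityMeasure μ] : Integrable (fun r => (F.toFun r.1 r.2).toReal) μ :=
  Integrable.of_bound F.measurable_toReal.aestronglyMeasurable 1
    (Filter.Eventually.of_forall fun r => by
      rw [Real.norm_eq_abs, abs_of_nonneg ENNReal.toReal_nonneg]; exact F.toReal_le_one _ _)

end SymTest

namespace ShuffleProtocol

variable {X : Type u} {W : Type w} {Y : Type v} {O : Type z}
  [MeasurableSpace W] [MeasurableSpace Y] [MeasurableSpace O] [Fintype X]

/-- The acceptance probability as an average over the datum of the first user, once the data of
the other users, drawn independently from `q`, are fixed. -/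
theorem accept_cons_replicate_toReal (P : ShuffleProtocol X W Y O) (n t : ℕ) (F : SymTest W Y)
    (p q : PMF X) : (P.accept n F (p :: List.replicate t q)).toReal =
      ∑ y : Fin t → X, (∏ i, q (y i)).toReal *
        ∑ x, (p x).toReal *
          ∫ r, (F.toFun r.1 r.2).toReal ∂(P.view n (t + 1) (Fin.cons x y)) := by
  have hl : p :: List.replicate t q = List.ofFn (Fin.cons p fun _ => q : Fin (t + 1) → PMF X) := by
    rw [List.ofFn_succ]
    simp [List.ofFn_const]
  have hI : ∀ z : Fin (t + 1) → X, ∫⁻ r, F.toFun r.1 r.2 ∂(P.view n (t + 1) z) ≠ ⊤ := by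
    intro z
    refine ((lintegral_mono fun r : W × MsgSeq Y => F.le_one r.1 r.2).trans_lt ?_).ne
    simp
  rw [hl, accept_ofFn, ← (Fin.consEquiv fun _ => X).sum_comp, Fintype.sum_prod_type_right,
    ENNReal.toReal_sum]
  · refine Finset.sum_congr rfl fun y _ => ?_
    rw [ENNReal.toReal_sum, Finset.mul_sum]
    · refine Finset.sum_congr rfl fun x _ => ?_
      rw [integral_toReal (f := fun r : W × MsgSeq Y => F.toFun r.1 r.2)
        F.measurable.aemeasurable
        (Filter.Eventually.of_forall fun r => (F.ne_top r.1 r.2).lt_top)]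
      rw [Fin.prod_univ_succ, ENNReal.toReal_mul]
      change (p x * ∏ i, q (y i)).toReal * _ = _
      rw [ENNReal.toReal_mul, mul_assoc, mul_left_comm]
      rfl
    · intro x _
      exact ENNReal.mul_ne_top (ENNReal.prod_ne_top fun i _ => PMF.apply_ne_top _ _) (hI _)
  · intro y _
    exact ENNReal.sum_ne_top.2 fun x _ =>
      ENNReal.mul_ne_top (ENNReal.prod_ne_top fun i _ => PMF.apply_ne_top _ _) (hI _)

/-- If each datum is drawn by first picking a color uniformly among three and then drawing from
the law of that color, the acceptance probability is an average over all colorings of the users. -/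
theorem accept_mixture (P : ShuffleProtocol X W Y O) (n h : ℕ) (F : SymTest W Y) (D : PMF X)
    (Q : Fin 3 → PMF X) (hD : ∀ x, D x = ∑ c, (3 : ℝ≥0∞)⁻¹ * Q c x) :
    P.accept n F (List.replicate h D) = (3 : ℝ≥0∞)⁻¹ ^ h *
      ∑ c : Fin h → Fin 3, P.accept n F (List.ofFn fun i => Q (c i)) := by
  rw [← List.ofFn_const, accept_ofFn]
  simp only [accept_ofFn]
  rw [Finset.sum_comm, Finset.mul_sum]
  refine Finset.sum_congr rfl fun x _ => ?_
  rw [← Finset.sum_mul, ← mul_assoc]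
  congr 1
  simp only [hD, ← Finset.mul_sum]
  rw [Finset.prod_mul_distrib, Finset.prod_const, Finset.card_univ, Fintype.card_fin,
    Finset.prod_univ_sum, Fintype.piFinset_univ]

end ShuffleProtocol

/-! ### Colorings of the users -/

theorem List.ofFn_ite_perm {α : Type*} {n : ℕ} (p : Fin n → Prop) [DecidablePred p] (a b : α) :
    (List.ofFn fun i => if p i then a else b).Perm
      (List.replicate (Finset.univ.filter fun i => ¬ p i).card b ++
        List.replicate (Finset.univ.filter p).card a) := by
  rw [← Multiset.coe_eq_coe, ← Multiset.coe_add, Multiset.coe_replicate, Multiset.coe_replicate,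
    List.ofFn_eq_map, ← Multiset.map_coe]
  change Multiset.map _ (Finset.univ : Finset (Fin n)).val = _
  rw [← Multiset.filter_add_not p (Finset.univ : Finset (Fin n)).val, Multiset.map_add, add_comm]
  congr 1
  · refine Multiset.eq_replicate.2 ⟨by simp [Finset.card_def], ?_⟩
    simp +contextual
  · refine Multiset.eq_replicate.2 ⟨by simp [Finset.card_def], ?_⟩
    simp +contextual

/-- In a uniformly random coloring of `n` points with three colors, color `0` is used at least
`n / 3` times with probability at least `1 / 3`: some color is, and the colors are symmetric. -/
theorem three_pow_le_card_colorings (n : ℕ) :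
    3 ^ n ≤ 3 * (Finset.univ.filter fun c : Fin n → Fin 3 =>
      n ≤ 3 * (Finset.univ.filter fun i => c i = 0).card).card := by
  classical
  have hcover : (Finset.univ : Finset (Fin n → Fin 3)) ⊆ Finset.univ.biUnion fun a : Fin 3 =>
      Finset.univ.filter fun c : Fin n → Fin 3 =>
        n ≤ 3 * (Finset.univ.filter fun i => c i = a).card := by
    intro c _
    simp only [Finset.mem_biUnion, Finset.mem_univ, Finset.mem_filter, true_and]
    by_contra! hc
    have hsum := Finset.card_eq_sum_card_fiberwise (s := (Finset.univ : Finset (Fin n)))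
      (t := (Finset.univ : Finset (Fin 3))) (f := c) (by simp)
    rw [Fin.sum_univ_three, Finset.card_univ, Fintype.card_fin] at hsum
    have h0 := hc 0
    have h1 := hc 1
    have h2 := hc 2
    omega
  have hsymm : ∀ a : Fin 3, (Finset.univ.filter fun c : Fin n → Fin 3 =>
      n ≤ 3 * (Finset.univ.filter fun i => c i = a).card).card =
      (Finset.univ.filter fun c : Fin n → Fin 3 =>
        n ≤ 3 * (Finset.univ.filter fun i => c i = 0).card).card := by
    intro a
    refine Finset.card_equiv (Equiv.subRight fun _ => a) fun c => ?_
    simp [sub_eq_zero]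
  calc 3 ^ n = (Finset.univ : Finset (Fin n → Fin 3)).card := by simp
    _ ≤ _ := Finset.card_le_card hcover
    _ ≤ _ := Finset.card_biUnion_le
    _ = _ := by simp [hsymm]

/-! ### The hybrid argument -/

section Parities

variable {d : ℕ} {W : Type w} {Y : Type v} {O : Type z}
  [MeasurableSpace W] [MeasurableSpace Y] [MeasurableSpace O]

/-- The hybrid step. If one of `t + 1` users draws its datum from the law of bias `3α` around
the signed parity that the test `F l b` is meant to detect, instead of the uniform law, then the
sum of the acceptance probabilities grows little: the difference is the average of
`∑ l b, b * character l x * F l b` over the view on datum `x`, and privacy lets the view depend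
on `x` only weakly. -/
theorem sum_accept_biasedLaw_cons_le (P : ShuffleProtocol (Example d) W Y O) {ε δ α : ℝ}
    (hε : 0 ≤ ε) (hδ : 0 ≤ δ) (hα : 0 ≤ α) (h3 : |3 * α| ≤ 1) (n t : ℕ)
    (hP : IsDifferentiallyPrivate (P.view n (t + 1)) ε δ) (L : Finset (Finset (Fin d)))
    (F : Finset (Fin d) → ℤˣ → SymTest W Y) :
    ∑ l ∈ L, ∑ b, (P.accept n (F l b) (biasedLaw l b (3 * α) h3 ::
        List.replicate t (PMF.uniformOfFintype (Example d)))).toReal ≤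
      ∑ l ∈ L, ∑ b, (P.accept n (F l b)
        (List.replicate (t + 1) (PMF.uniformOfFintype (Example d)))).toReal +
      3 * α * ((Real.exp ε - 1) * √(L.card) + 2 * δ * L.card) := by
  set U := PMF.uniformOfFintype (Example d) with hU
  set Δ := 3 * α * ((Real.exp ε - 1) * √(L.card) + 2 * δ * L.card) with hΔ
  set N : ℝ := (Fintype.card (Example d) : ℝ) with hN
  have hN0 : 0 < N := Nat.cast_pos.2 Fintype.card_pos
  -- The two signs of the same support share a character, so they enter through one coefficient.
  let a : Finset (Fin d) → W × MsgSeq Y → ℝ := fun l r =>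
    ∑ b : ℤˣ, ((b : ℤ) : ℝ) * ((F l b).toFun r.1 r.2).toReal
  have ha : ∀ l r, |a l r| ≤ 1 := by
    intro l r
    have h1 := (F l 1).toReal_le_one r.1 r.2
    have h2 := (F l (-1)).toReal_le_one r.1 r.2
    have h1' : 0 ≤ ((F l 1).toFun r.1 r.2).toReal := ENNReal.toReal_nonneg
    have h2' : 0 ≤ ((F l (-1)).toFun r.1 r.2).toReal := ENNReal.toReal_nonneg
    simp only [a, UnitsInt.univ]
    rw [Finset.sum_pair (by decide)]
    simp only [Units.val_one, Int.cast_one, one_mul, Units.val_neg, Int.cast_neg, neg_mul]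
    rw [abs_le]
    constructor <;> linarith
  have hame : ∀ l, Measurable (a l) := fun l =>
    Finset.measurable_fun_sum _ fun b _ => ((F l b).measurable_toReal).const_mul _
  have main : ∀ y : Fin t → Example d,
      ∑ x, ∫ r, (∑ l ∈ L, a l r * character l x) ∂(P.view n (t + 1) (Fin.cons x y)) ≤
        N * ((Real.exp ε - 1) * √(L.card) + 2 * δ * L.card) := by
    intro y
    refine sum_integral_le_of_indistinguishable
      (fun x => P.view n (t + 1) (Fin.cons x y)) hε hδ (Nat.cast_nonneg _) (Real.sqrt_nonneg _)
      ?_ (fun x r => ∑ l ∈ L, a l r * character l x) ?_ ?_ ?_ ?_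
    · intro x x' S hS
      refine hP _ _ ?_ S hS
      intro i hi j hj
      have : ∀ k : Fin (t + 1), (Fin.cons x y : Fin (t + 1) → Example d) k ≠
          (Fin.cons x' y : Fin (t + 1) → Example d) k → k = 0 := by
        intro k
        refine Fin.cases (fun _ => rfl) (fun k hk => ?_) k
        simp at hk
      rw [this i hi, this j hj]
    · exact fun x => Finset.measurable_fun_sum _ fun l _ => (hame l).mul_const _
    · intro x r
      refine (Finset.abs_sum_le_sum_abs _ _).trans ?_
      calc ∑ l ∈ L, |a l r * character l x| ≤ ∑ l ∈ L, (1 : ℝ) :=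
            Finset.sum_le_sum fun l _ => by rw [abs_mul, abs_character, mul_one]; exact ha l r
        _ = L.card := by simp
    · intro r
      rw [Finset.sum_comm]
      exact Finset.sum_eq_zero fun l _ => by rw [← Finset.mul_sum, sum_character, mul_zero]
    · intro r
      rw [sum_sq_sum_character, Real.sq_sqrt (Nat.cast_nonneg _)]
      gcongr
      calc ∑ l ∈ L, a l r ^ 2 ≤ ∑ l ∈ L, (1 : ℝ) :=
            Finset.sum_le_sum fun l _ => (sq_le_one_iff_abs_le_one _).2 (ha l r)
        _ = L.card := by simp
  have diff : ∑ l ∈ L, ∑ b, (P.accept n (F l b) (biasedLaw l b (3 * α) h3 ::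
        List.replicate t U)).toReal -
      ∑ l ∈ L, ∑ b, (P.accept n (F l b) (List.replicate (t + 1) U)).toReal =
      ∑ y : Fin t → Example d, (∏ i, U (y i)).toReal * (3 * α / N *
        ∑ x, ∫ r, (∑ l ∈ L, a l r * character l x) ∂(P.view n (t + 1) (Fin.cons x y))) := by
    have hint : ∀ (y : Fin t → Example d) x,
        ∫ r, (∑ l ∈ L, a l r * character l x) ∂(P.view n (t + 1) (Fin.cons x y)) =
        ∑ l ∈ L, ∑ b : ℤˣ, ((b : ℤ) : ℝ) * character l x *
          ∫ r, ((F l b).toFun r.1 r.2).toReal ∂(P.view n (t + 1) (Fin.cons x y)) := by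
      intro y x
      have hi : ∀ l b, Integrable (fun r => (((b : ℤˣ) : ℤ) : ℝ) * ((F l b).toFun r.1 r.2).toReal)
          (P.view n (t + 1) (Fin.cons x y)) := fun l b =>
        ((F l b).integrable_toReal _).const_mul _
      have hal : ∀ l, Integrable (a l) (P.view n (t + 1) (Fin.cons x y)) := fun l =>
        integrable_finsetSum _ fun b _ => hi l b
      rw [integral_finsetSum _ fun l _ => (hal l).mul_const _]
      refine Finset.sum_congr rfl fun l _ => ?_
      rw [integral_mul_const, integral_finsetSum _ fun b _ => hi l b, Finset.sum_mul]
      refine Finset.sum_congr rfl fun b _ => ?_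
      rw [integral_const_mul]
      ring
    rw [← Finset.sum_sub_distrib]
    simp only [← Finset.sum_sub_distrib, List.replicate_succ,
      ShuffleProtocol.accept_cons_replicate_toReal, hint]
    simp only [← mul_sub, ← sub_mul, ← Finset.sum_sub_distrib, hU, biasedLaw_toReal,
      uniform_toReal]
    simp only [Finset.mul_sum]
    rw [Finset.sum_congr rfl fun l _ => Finset.sum_comm, Finset.sum_comm]
    refine Finset.sum_congr rfl fun y _ => ?_
    rw [Finset.sum_congr rfl fun l _ => Finset.sum_comm, Finset.sum_comm]
    refine Finset.sum_congr rfl fun x _ => Finset.sum_congr rfl fun l _ =>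
      Finset.sum_congr rfl fun b _ => ?_
    rw [← hN]
    field_simp
    ring
  have hw : ∑ y : Fin t → Example d, (∏ i, U (y i)).toReal = 1 := by
    rw [← ENNReal.toReal_sum fun y _ => ENNReal.prod_ne_top fun i _ => PMF.apply_ne_top _ _,
      PMF.sum_prod_pi fun _ => U, ENNReal.toReal_one]
  have hbound : ∑ y : Fin t → Example d, (∏ i, U (y i)).toReal * (3 * α / N *
        ∑ x, ∫ r, (∑ l ∈ L, a l r * character l x) ∂(P.view n (t + 1) (Fin.cons x y))) ≤ Δ := by
    calc _ ≤ ∑ y : Fin t → Example d, (∏ i, U (y i)).toReal * Δ := by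
          refine Finset.sum_le_sum fun y _ => mul_le_mul_of_nonneg_left ?_ ENNReal.toReal_nonneg
          calc _ ≤ 3 * α / N * (N * ((Real.exp ε - 1) * √(L.card) + 2 * δ * L.card)) :=
                mul_le_mul_of_nonneg_left (main y) (by positivity)
            _ = Δ := by rw [hΔ]; field_simp
      _ = Δ := by rw [← Finset.sum_mul, hw, one_mul]
  linarith

/-- The hybrid argument: `j` users with biased data are replaced by users with uniform data one
by one. The users that are still biased only post-process the view of the others. -/
theorem sum_accept_replicate_le (P : ShuffleProtocol (Example d) W Y O) {ε δ α : ℝ}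
    (hε : 0 ≤ ε) (hδ : 0 ≤ δ) (hα : 0 ≤ α) (h3 : |3 * α| ≤ 1) (n : ℕ)
    (L : Finset (Finset (Fin d))) (F : Finset (Fin d) → ℤˣ → SymTest W Y) :
    ∀ j t : ℕ, (∀ h, t < h → h ≤ j + t → IsDifferentiallyPrivate (P.view n h) ε δ) →
    ∑ l ∈ L, ∑ b, (P.accept n (F l b) (List.replicate j (biasedLaw l b (3 * α) h3) ++
        List.replicate t (PMF.uniformOfFintype (Example d)))).toReal ≤
      ∑ l ∈ L, ∑ b, (P.accept n (F l b)
        (List.replicate (j + t) (PMF.uniformOfFintype (Example d)))).toReal +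
      j * (3 * α * ((Real.exp ε - 1) * √(L.card) + 2 * δ * L.card))
  | 0, t, _ => by simp
  | j + 1, t, hP => by
    have ih := sum_accept_replicate_le P hε hδ hα h3 n L F j (t + 1)
      fun h h1 h2 => hP h (by omega) (by omega)
    have step := sum_accept_biasedLaw_cons_le P hε hδ hα h3 n t (hP _ (by omega) (by omega)) L
      fun l b => (List.replicate j (biasedLaw l b (3 * α) h3)).foldl (P.addUser n) (F l b)
    simp only [← ShuffleProtocol.accept_append] at step
    have e1 : ∀ l b, List.replicate (j + 1) (biasedLaw l b (3 * α) h3) ++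
        List.replicate t (PMF.uniformOfFintype (Example d)) =
        List.replicate j (biasedLaw l b (3 * α) h3) ++ biasedLaw l b (3 * α) h3 ::
          List.replicate t (PMF.uniformOfFintype (Example d)) := by
      intro l b
      rw [List.replicate_succ', List.append_assoc, List.singleton_append]
    simp only [e1]
    have e2 : j + 1 + t = j + (t + 1) := by omega
    rw [e2]
    push_cast
    linarith

end Parities

/-! ### From learning to the lower bound -/

section Learning

variable {d : ℕ} {W : Type w} {Y : Type v} [MeasurableSpace W] [MeasurableSpace Y]

/-- The test that runs the analyzer and accepts if it outputs the signed parity `(l, b)`. -/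
noncomputable def outputTest (P : ShuffleProtocol (Example d) W Y (SignedParity d)) (n : ℕ)
    (l : Finset (Fin d)) (b : ℤˣ) : SymTest W Y :=
  SymTest.ofKernel (P.analyzer n) {⟨l, b⟩} trivial

theorem accept_outputTest (P : ShuffleProtocol (Example d) W Y (SignedParity d)) (n : ℕ)
    (l : Finset (Fin d)) (b : ℤˣ) (D : PMF (Example d)) :
    P.accept n (outputTest P n l b) (List.replicate n D) =
      ∑ x : Fin n → Example d, (∏ i, D (x i)) * P.run n x {⟨l, b⟩} := by
  rw [← List.ofFn_const, ShuffleProtocol.accept_ofFn]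
  refine Finset.sum_congr rfl fun x _ => ?_
  rw [ShuffleProtocol.run_apply P n x (S := {⟨l, b⟩}) trivial]
  rfl

theorem sum_accept_outputTest_le_one (P : ShuffleProtocol (Example d) W Y (SignedParity d))
    (n : ℕ) (L : Finset (Finset (Fin d))) (D : PMF (Example d)) :
    ∑ l ∈ L, ∑ b, (P.accept n (outputTest P n l b) (List.replicate n D)).toReal ≤ 1 := by
  have hfin : ∀ l b, P.accept n (outputTest P n l b) (List.replicate n D) ≠ ⊤ := fun l b =>
    ((P.accept_le_one _ _ _).trans_lt ENNReal.one_lt_top).ne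
  have hrun : ∀ x, ∑ q ∈ L ×ˢ (Finset.univ : Finset ℤˣ), P.run n x {⟨q.1, q.2⟩} ≤ 1 := by
    intro x
    rw [← measure_univ (μ := P.run n x)]
    refine sum_measure_le_measure_univ (fun q _ => MeasurableSet.nullMeasurableSet trivial) ?_
    intro q _ q' _ hqq'
    refine Disjoint.aedisjoint (Set.disjoint_singleton.2 fun h => hqq' ?_)
    injection h with h1 h2
    exact Prod.ext h1 h2
  have key : ∑ q ∈ L ×ˢ (Finset.univ : Finset ℤˣ),
      P.accept n (outputTest P n q.1 q.2) (List.replicate n D) ≤ 1 := by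
    simp only [accept_outputTest]
    rw [Finset.sum_comm]
    calc _ = ∑ x : Fin n → Example d, (∏ i, D (x i)) *
          ∑ q ∈ L ×ˢ (Finset.univ : Finset ℤˣ), P.run n x {⟨q.1, q.2⟩} := by
          simp only [Finset.mul_sum]
      _ ≤ ∑ x : Fin n → Example d, (∏ i, D (x i)) * 1 := by
          gcongr with x
          exact hrun x
      _ = 1 := by simp only [mul_one]; exact PMF.sum_prod_pi fun _ => D
  rw [← Finset.sum_product', ← ENNReal.toReal_sum fun q _ => hfin _ _]
  exact ENNReal.toReal_le_of_le_ofReal zero_le_one (by simpa using key)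

theorem le_accept_outputTest (P : ShuffleProtocol (Example d) W Y (SignedParity d)) {k n : ℕ}
    {α : ℝ} (hα : 0 < α) (h2 : |2 * α| ≤ 1) (hL : P.LearnsSignedParities k α n)
    {l : Finset (Fin d)} (hl : l.card ≤ k) (b : ℤˣ) :
    (99 / 100 : ℝ≥0∞) ≤ P.accept n (outputTest P n l b)
      (List.replicate n (biasedLaw l b (2 * α) h2)) := by
  rw [accept_outputTest]
  refine (hL (biasedLaw l b (2 * α) h2)).trans ?_
  gcongr with x
  exact fun f hf => eq_of_err_lt l b hα h2 f (hf ⟨l, b⟩ hl)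

/-- The trade-off between the number of samples and the cost of a hybrid step. -/
theorem card_le_mul_of_learns (P : ShuffleProtocol (Example d) W Y (SignedParity d)) {k n : ℕ}
    {ε δ α : ℝ} (hk : 1 ≤ k) (hkd : k ≤ d) (hα : 0 < α) (hα3 : α ≤ 1 / 3) (hε : 0 ≤ ε)
    (hδ : 0 ≤ δ) (hP : P.RobustlyPrivate ε δ (1 / 3)) (hL : P.LearnsSignedParities k α n) :
    9 / 10 * (chooseLE d k : ℝ) ≤
      n * (3 * α * ((Real.exp ε - 1) * √(chooseLE d k) + 2 * δ * chooseLE d k)) := by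
  have h3 : |3 * α| ≤ 1 := by rw [abs_of_pos (by positivity)]; linarith
  have h2 : |2 * α| ≤ 1 := by rw [abs_of_pos (by positivity)]; linarith
  have hC : (1 : ℝ) ≤ chooseLE d k := by exact_mod_cast one_le_chooseLE hk hkd
  set L := supports d k with hLdef
  have hLC : (L.card : ℝ) = chooseLE d k := by rw [hLdef, card_supports]
  set U := PMF.uniformOfFintype (Example d) with hU
  set F := outputTest P n with hF
  set C : ℝ := (chooseLE d k : ℝ) with hCdef
  set Δ := 3 * α * ((Real.exp ε - 1) * √C + 2 * δ * C) with hΔ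
  have hΔ0 : 0 ≤ Δ := by
    have := Real.one_le_exp hε
    have : 0 ≤ Real.exp ε - 1 := by linarith
    positivity
  -- `A c` is the sum over all signed parities of the success probabilities when exactly the users
  -- of color `0` in `c` have uniform data.
  let A : (Fin n → Fin 3) → ℝ := fun c => ∑ l ∈ L, ∑ b : ℤˣ,
    (P.accept n (F l b)
      (List.ofFn fun i => if c i = 0 then U else biasedLaw l b (3 * α) h3)).toReal
  have hA2 : ∀ c, A c ≤ 2 * C := by
    intro c
    calc A c ≤ ∑ l ∈ L, ∑ b : ℤˣ, (1 : ℝ) :=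
          Finset.sum_le_sum fun l _ => Finset.sum_le_sum fun b _ =>
            ENNReal.toReal_le_of_le_ofReal zero_le_one (by simpa using P.accept_le_one _ _ _)
      _ = 2 * C := by simp [hLC, mul_comm]
  have hAgood : ∀ c : Fin n → Fin 3,
      n ≤ 3 * (Finset.univ.filter fun i => c i = 0).card → A c ≤ 1 + n * Δ := by
    intro c hc
    set t := (Finset.univ.filter fun i => c i = 0).card with ht
    set j := (Finset.univ.filter fun i => ¬ c i = 0).card with hj
    have hjt : j + t = n := by
      have := Finset.card_filter_add_card_filter_not (s := (Finset.univ : Finset (Fin n)))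
        (fun i => c i = 0)
      rw [Finset.card_univ, Fintype.card_fin] at this
      omega
    have hpriv : ∀ h, t < h → h ≤ j + t → IsDifferentiallyPrivate (P.view n h) ε δ := by
      intro h h1 h2
      refine hP n h ?_ (by omega)
      have : (n : ℝ) ≤ 3 * h := by exact_mod_cast (by omega : n ≤ 3 * h)
      linarith
    have hyb := sum_accept_replicate_le P hε hδ hα.le h3 n L F j t hpriv
    rw [hjt, hLC] at hyb
    have hone := sum_accept_outputTest_le_one P n L U
    have hjn : (j : ℝ) * Δ ≤ n * Δ := by
      have : (j : ℝ) ≤ n := by exact_mod_cast (by omega : j ≤ n)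
      gcongr
    have hAc : A c = ∑ l ∈ L, ∑ b : ℤˣ, (P.accept n (F l b)
        (List.replicate j (biasedLaw l b (3 * α) h3) ++ List.replicate t U)).toReal := by
      refine Finset.sum_congr rfl fun l _ => Finset.sum_congr rfl fun b _ => ?_
      rw [P.accept_perm n (F l b) (List.ofFn_ite_perm (fun i => c i = 0) U _)]
    rw [hAc]
    linarith
  have hsum : 99 / 100 * (2 * C) * 3 ^ n ≤ ∑ c, A c := by
    have hv : ∀ l ∈ L, ∀ b : ℤˣ, (99 / 100 : ℝ) * 3 ^ n ≤ ∑ c : Fin n → Fin 3,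
        (P.accept n (F l b)
          (List.ofFn fun i => if c i = 0 then U else biasedLaw l b (3 * α) h3)).toReal := by
      intro l hl b
      have h := le_accept_outputTest P hα h2 hL (card_le_of_mem_supports hl) b
      rw [P.accept_mixture n n _ _ _ (biasedLaw_eq_mixture l b h2 h3)] at h
      have hfin : ∀ c : Fin n → Fin 3, P.accept n (F l b)
          (List.ofFn fun i => if c i = 0 then U else biasedLaw l b (3 * α) h3) ≠ ⊤ := fun c =>
        ((P.accept_le_one _ _ _).trans_lt ENNReal.one_lt_top).ne
      have h' := ENNReal.toReal_mono (ENNReal.mul_ne_top (by simp)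
        (ENNReal.sum_ne_top.2 fun c _ => hfin c)) h
      rw [ENNReal.toReal_mul, ENNReal.toReal_sum fun c _ => hfin c] at h'
      simp only [ENNReal.toReal_pow, ENNReal.toReal_inv, ENNReal.toReal_ofNat,
        ENNReal.toReal_div] at h'
      rw [inv_pow, inv_mul_eq_div, le_div_iff₀ (by positivity)] at h'
      exact h'
    calc 99 / 100 * (2 * C) * 3 ^ n = ∑ l ∈ L, ∑ b : ℤˣ, (99 / 100 : ℝ) * 3 ^ n := by
          simp [hLC]; ring
      _ ≤ _ := Finset.sum_le_sum fun l hl => Finset.sum_le_sum fun b _ => hv l hl b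
      _ = ∑ c, A c := by
          rw [Finset.sum_congr rfl fun l _ => Finset.sum_comm, Finset.sum_comm]
  -- If `n Δ < 9 C / 10`, at least a third of the colorings have average success probability at
  -- most `1/2 + 9/20`, so the overall failure probability is at least `1/60 > 1/100`: here
  -- `(1 + 9 C / 10) / (2 C) ≤ 19/20` as `C ≥ 1`.
  by_contra! hcon
  set good := Finset.univ.filter fun c : Fin n → Fin 3 =>
    n ≤ 3 * (Finset.univ.filter fun i => c i = 0).card with hgood
  have hupper : ∑ c, A c ≤ 2 * C * 3 ^ n - (2 * C - 1 - n * Δ) * good.card := by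
    calc ∑ c, A c ≤ ∑ c, (2 * C - if c ∈ good then 2 * C - 1 - n * Δ else 0) := by
          refine Finset.sum_le_sum fun c _ => ?_
          split_ifs with hc
          · linarith [hAgood c (Finset.mem_filter.1 hc).2]
          · linarith [hA2 c]
      _ = _ := by
          rw [Finset.sum_sub_distrib, Finset.sum_ite_mem]
          simp
          ring
  have hcard : (3 : ℝ) ^ n ≤ 3 * good.card := by exact_mod_cast three_pow_le_card_colorings n
  have hgap : C / 10 ≤ 2 * C - 1 - n * Δ := by linarith
  have hm : C / 10 * (3 ^ n / 3) ≤ (2 * C - 1 - n * Δ) * good.card := by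
    exact mul_le_mul hgap (by linarith) (by positivity) (by linarith)
  have : 0 < C * 3 ^ n := by positivity
  linarith

end Learning

/-- The condition on `δ` makes the additive privacy loss negligible. -/
theorem two_mul_delta_mul_le {ε₀ ε δ α C : ℝ} (hε₀ : 0 < ε₀) (hC : 1 ≤ C) (hα : 0 < α)
    (hα1 : α ≤ 1) (hε : 0 < ε) (hεε₀ : ε ≤ ε₀) (hδ : 0 ≤ δ) (hδ2 : δ ≤ 1 / 2)
    (h : δ * Real.log (C / δ) ≤ 1 / (4 * ε₀) * (α ^ 2 * ε ^ 2 / C)) : 2 * δ * C ≤ ε := by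
  have hlog : δ * (1 / 2) ≤ δ * Real.log (C / δ) := by
    rcases hδ.eq_or_lt with h0 | h0
    · simp [← h0]
    · gcongr
      have h2 : (2 : ℝ) ≤ C / δ := by rw [le_div_iff₀ h0]; linarith
      have := Real.log_le_log (by norm_num) h2
      linarith [Real.log_two_gt_d9]
  have h1 : δ * (1 / 2) * C ≤ 1 / (4 * ε₀) * (α ^ 2 * ε ^ 2) := by
    have := mul_le_mul_of_nonneg_right (hlog.trans h) (by linarith : 0 ≤ C)
    calc _ ≤ _ := this
      _ = _ := by field_simp
  have h2 : 1 / (4 * ε₀) * (α ^ 2 * ε ^ 2) ≤ 1 / (4 * ε₀) * (1 * (ε * ε₀)) := by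
    have ha : α ^ 2 ≤ 1 := by nlinarith
    have he : ε ^ 2 ≤ ε * ε₀ := by nlinarith
    gcongr
  have h3 : 1 / (4 * ε₀) * (1 * (ε * ε₀)) = ε / 4 := by field_simp
  linarith

theorem exp_sub_one_le_mul_exp {ε ε₀ : ℝ} (hε : 0 ≤ ε) (h : ε ≤ ε₀) :
    Real.exp ε - 1 ≤ ε * Real.exp ε₀ := by
  have h1 : 1 - ε ≤ Real.exp (-ε) := by linarith [Real.add_one_le_exp (-ε)]
  have h2 : Real.exp (-ε) * Real.exp ε = 1 := by rw [← Real.exp_add]; simp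
  have h3 := mul_le_mul_of_nonneg_right h1 (Real.exp_pos ε).le
  have h4 : ε * Real.exp ε ≤ ε * Real.exp ε₀ := by gcongr
  linarith

theorem two_rpow_half_le {d : ℕ} (hd : 1 ≤ d) :
    (2 : ℝ) ^ ((d : ℝ) / 2) ≤ 2 * √(chooseLE d d) := by
  have h1 : (2 : ℝ) ^ ((d : ℝ) / 2) = √((2 : ℝ) ^ d) := by
    rw [Real.sqrt_eq_rpow, ← Real.rpow_natCast, ← Real.rpow_mul (by norm_num)]
    congr 1
    ring
  have h2 : (2 : ℝ) ^ d ≤ 2 * chooseLE d d := by exact_mod_cast two_pow_le_two_mul_chooseLE hd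
  rw [h1, Real.sqrt_le_left (by positivity), mul_pow, Real.sq_sqrt (Nat.cast_nonneg _)]
  linarith [(Nat.cast_nonneg (chooseLE d d) : (0 : ℝ) ≤ _)]

theorem mainTheorem3 (ε₀ : ℝ) (hε₀ : 0 < ε₀) :
    ∃ c₁ c₂ : ℝ, 0 < c₁ ∧ 0 < c₂ ∧
      ∀ (W : Type w) (Y : Type v) [MeasurableSpace W] [MeasurableSpace Y] (d k n : ℕ)
        (P : ShuffleProtocol (Example d) W Y (SignedParity d)) (ε δ α : ℝ),
        1 ≤ k → k ≤ d → 0 < α → α ≤ 1 / 3 → 0 < ε → ε ≤ ε₀ → 0 ≤ δ → δ ≤ 1 / 2 →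
        δ * Real.log (chooseLE d k / δ) ≤ c₁ * (α ^ 2 * ε ^ 2 / chooseLE d k) →
        P.RobustlyPrivate ε δ (1 / 3) →
        P.LearnsSignedParities k α n →
        c₂ * (Real.sqrt (chooseLE d k) / (α * ε)) ≤ n ∧
          (k = d → c₂ * ((2 : ℝ) ^ ((d : ℝ) / 2) / (α * ε)) ≤ n) := by
  -- `c₁` makes `2 δ C ≤ ε`, so that a hybrid step costs at most `3 α ε (exp ε₀ + 1) √C`; `c₂` leaves
  -- room for the factor in `2 ^ (d / 2) ≤ 2 √C`.
  refine ⟨1 / (4 * ε₀), 1 / (10 * (Real.exp ε₀ + 1)), by positivity, by positivity, ?_⟩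
  intro W Y _ _ d k n P ε δ α hk hkd hα hα3 hε hεε₀ hδ hδ2 hlog hP hL
  have hC : (1 : ℝ) ≤ chooseLE d k := by exact_mod_cast one_le_chooseLE hk hkd
  have main := card_le_mul_of_learns P hk hkd hα hα3 hε.le hδ hP hL
  have hδC := two_mul_delta_mul_le hε₀ hC hα (by linarith) hε hεε₀ hδ hδ2 hlog
  have hexp := exp_sub_one_le_mul_exp hε.le hεε₀
  set s := √(chooseLE d k : ℝ) with hs
  have hs1 : 1 ≤ s := by rw [hs]; exact Real.one_le_sqrt.2 hC
  have hs0 : 0 < s := by linarith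
  have hss : (chooseLE d k : ℝ) = s * s := (Real.mul_self_sqrt (Nat.cast_nonneg _)).symm
  have hcost : (Real.exp ε - 1) * s + 2 * δ * chooseLE d k ≤ ε * (Real.exp ε₀ + 1) * s := by
    nlinarith [mul_le_mul_of_nonneg_right hexp hs0.le, mul_le_mul_of_nonneg_left hs1 hε.le]
  have hn : 9 / 10 * s ≤ n * (3 * α * (ε * (Real.exp ε₀ + 1))) := by
    have h1 : 9 / 10 * (s * s) ≤ n * (3 * α * (ε * (Real.exp ε₀ + 1) * s)) := by
      rw [← hss]
      refine main.trans ?_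
      gcongr
    refine le_of_mul_le_mul_right ?_ hs0
    linarith
  have hfinal : ∀ r : ℝ, r ≤ 2 * s →
      1 / (10 * (Real.exp ε₀ + 1)) * (r / (α * ε)) ≤ n := by
    intro r hr
    have hE := Real.exp_pos ε₀
    rw [div_mul_div_comm, one_mul, div_le_iff₀ (by positivity)]
    linarith
  refine ⟨hfinal s (by linarith), fun hkd' => ?_⟩
  subst hkd'
  exact hfinal _ (two_rpow_half_le hk)
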